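/- Let $F$ be Thompson's group, that is, the group of all strictly increasing piecewise linear homeomorphisms of $[0,1]$ whose finitely many breakpoints are dyadic rationals and whose slopes are integer powers of $2$. It is generated by $$x_0(t)=\begin{cases}\frac t2,&0\le t\le\frac12,\\ t-\frac14,&\frac12\le t\le\frac34,\\ 2t-1,&\frac34\le t\le1,\end{cases}\qquad x_1(t)=\begin{cases}t,&0\le t\le\frac12,\\ \frac t2+\frac14,&\frac12\le t\le\frac34,\\ t-\frac18,&\frac34\le t\le\frac78,\\ 2t-1,&\frac78\le t\le1.\end{cases}$$ The standard action of $F$ on the Cantor set $\{0,1\}^\omega$ is the action by homeomorphisms induced by binary expansions: $f$ sends $w$ to a binary expansion of $f(0.w)$, namely to the one ending in $111\ldots$ if $w$ ends in $111\ldots$, and to the one not ending in $111\ldots$ otherwise. For a dyadic rational $q\in(0,1)$ let $\Gamma_q$ be the pointed Schreier graph of the action of $F$ on the orbit of $q$ (which is the set of all dyadic rationals in $(0,1)$) with respect to $\{x_0,x_1\}$: its vertices are the points of the orbit, for each $s\in\{x_0,x_1\}$ there is an arrow labeled $s$ from each vertex $v$ to $s(v)$, and the selected vertex is $q$. Let $\mathcal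 T$ be the space of isomorphism classes of connected pointed graphs with arrows labeled by $x_0,x_1$ such that each vertex has exactly one outgoing and exactly one incoming arrow with each label, with the topology of the distance $2^{-n}$, where $n$ is the largest integer such that the balls of radius $n$ centered at the selected vertices are isomorphic as pointed labeled graphs. Let $\bar{\mathcal C}$ be the closure in $\mathcal T$ of $\mathcal C=\{\Gamma_q : q\in(0,1)\text{ a dyadic rational}\}$. **Theorem.** The action $f\cdot\Gamma_q=\Gamma_{f(q)}$ of $F$ on $\mathcal C$ by shifting the selected vertex extends uniquely to an action of $F$ on $\bar{\mathcal C}$ by continuous maps (the Schreier dynamical system). The perfect kernel $\mathcal D$ of $\bar{\mathcal C}$ (what is left after removing isolated points transfinitely often) is invariant under this action, and the action of $F$ on $\mathcal D$ is topologically conjugate to the standard action of $F$ on $\{0,1\}^\omega$: there is a homeomorphism $\psi\colon\mathcal D\to\{0,1\}^\omega$ such that $\psi(f\cdot\Gamma)=f\cdot\psi(\Gamma)$ for all $f\in F$ and $\Gamma\in\mathcal D$. Moreover, $\psi(\Gamma)$ is the label of the selected vertex of $\Gamma$, that is, the limit of the binary expansions (with finitely many digits $1$) of dyadic rationals $q$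 as $\Gamma_q\to\Gamma$. -/

import Mathlib

open scoped Topology

namespace ThompsonSchreier

noncomputable section

/-! ## Thompson's group `F` -/

/-- The closed unit interval. -/
abbrev I01 : Type := Set.Icc (0 : ℝ) 1

/-- Dyadic rational numbers. -/
def IsDyadic (x : ℝ) : Prop := ∃ (k : ℤ) (n : ℕ), x = k / 2 ^ n

theorem IsDyadic.zero : IsDyadic 0 := ⟨0, 0, by simp⟩

theorem IsDyadic.one : IsDyadic 1 := ⟨1, 0, by simp⟩

theorem IsDyadic.add {x y : ℝ} (hx : IsDyadic x) (hy : IsDyadic y) : IsDyadic (x + y) := by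
  obtain ⟨k, n, rfl⟩ := hx
  obtain ⟨l, m, rfl⟩ := hy
  refine ⟨k * 2 ^ m + l * 2 ^ n, n + m, ?_⟩
  push_cast
  rw [pow_add]
  field_simp

theorem IsDyadic.neg {x : ℝ} (hx : IsDyadic x) : IsDyadic (-x) := by
  obtain ⟨k, n, rfl⟩ := hx
  exact ⟨-k, n, by push_cast; ring⟩

theorem IsDyadic.sub {x y : ℝ} (hx : IsDyadic x) (hy : IsDyadic y) : IsDyadic (x - y) := by
  rw [sub_eq_add_neg]
  exact hx.add hy.neg

theorem IsDyadic.zpow_mul {x : ℝ} (hx : IsDyadic x) (e : ℤ) : IsDyadic ((2 : ℝ) ^ e * x) := by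
  obtain ⟨k, n, rfl⟩ := hx
  rcases Int.eq_nat_or_neg e with ⟨m, rfl | rfl⟩
  · refine ⟨2 ^ m * k, n, ?_⟩
    push_cast
    rw [zpow_natCast]
    ring
  · refine ⟨k, n + m, ?_⟩
    rw [zpow_neg, zpow_natCast, pow_add]
    field_simp

/-- A strictly increasing homeomorphism `f` of `[0,1]` (an order automorphism) is a
*Thompson homeomorphism* if there is a finite set `s` of dyadic rationals such that on every
interval whose interior avoids `s` it is affine with slope an integer power of `2`. -/
def IsThompson (f : I01 ≃o I01) : Prop :=
  ∃ s : Finset ℝ, (∀ c ∈ s, IsDyadic c) ∧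
    ∀ a b : I01, a ≤ b → (∀ c ∈ s, ¬ ((a : ℝ) < c ∧ c < (b : ℝ))) →
      ∃ (n : ℤ) (d : ℝ), ∀ t : I01, a ≤ t → t ≤ b → (f t : ℝ) = 2 ^ n * (t : ℝ) + d

theorem IsThompson.isDyadic {f : I01 ≃o I01} (hf : IsThompson f) {t : I01}
    (ht : IsDyadic (t : ℝ)) : IsDyadic (f t : ℝ) := by
  obtain ⟨s, hs, hf⟩ := hf
  induction hN : (s.filter (fun c => 0 < c ∧ c < (t : ℝ))).card using Nat.strong_induction_on
    generalizing t with
  | _ N ih =>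
  have key : ∀ a : I01, a ≤ t → IsDyadic (a : ℝ) → IsDyadic (f a : ℝ) →
      (∀ c ∈ s, ¬ ((a : ℝ) < c ∧ c < (t : ℝ))) → IsDyadic (f t : ℝ) := by
    intro a hat ha hfa hav
    obtain ⟨n, d, h⟩ := hf a t hat hav
    have h1 := h a le_rfl hat
    have h2 := h t hat le_rfl
    have : (f t : ℝ) = f a + 2 ^ n * ((t : ℝ) - a) := by rw [h1, h2]; ring
    rw [this]
    exact hfa.add ((ht.sub ha).zpow_mul n)
  rcases (s.filter (fun c => 0 < c ∧ c < (t : ℝ))).eq_empty_or_nonempty with he | hne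
  · have h0 : f (⊥ : I01) = ⊥ := f.map_bot
    refine key ⊥ bot_le IsDyadic.zero (by rw [h0]; exact IsDyadic.zero) ?_
    intro c hc hct
    have : c ∈ s.filter (fun c => 0 < c ∧ c < (t : ℝ)) := Finset.mem_filter.2 ⟨hc, hct⟩
    rw [he] at this
    simp at this
  · obtain ⟨hm1, hm2⟩ := Finset.mem_filter.1 (Finset.max'_mem _ hne)
    set m := (s.filter (fun c => 0 < c ∧ c < (t : ℝ))).max' hne with hm
    have hmI : m ∈ Set.Icc (0 : ℝ) 1 := ⟨hm2.1.le, hm2.2.le.trans t.2.2⟩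
    refine key ⟨m, hmI⟩ hm2.2.le (hs m hm1) ?_ ?_
    · refine ih _ ?_ (t := ⟨m, hmI⟩) (hs m hm1) rfl
      rw [← hN]
      refine Finset.card_lt_card ?_
      refine ⟨fun c hc => ?_, fun h => ?_⟩
      · have := Finset.mem_filter.1 hc
        exact Finset.mem_filter.2 ⟨this.1, this.2.1, this.2.2.trans hm2.2⟩
      · have := h (Finset.mem_filter.2 ⟨hm1, hm2⟩)
        exact lt_irrefl _ (Finset.mem_filter.1 this).2.2
    · intro c hc hct
      have : c ≤ m := Finset.le_max' _ _ (Finset.mem_filter.2 ⟨hc, hm2.1.trans hct.1, hct.2⟩)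
      exact absurd hct.1 (not_lt.2 this)

theorem IsThompson.one : IsThompson 1 :=
  ⟨∅, by simp, fun _ _ _ _ => ⟨0, 0, fun t _ _ => by simp⟩⟩

theorem IsThompson.inv {f : I01 ≃o I01} (hf : IsThompson f) : IsThompson f⁻¹ := by
  classical
  have hd := @IsThompson.isDyadic f hf
  obtain ⟨s, hs, hf⟩ := hf
  refine ⟨s.image (fun c => if h : c ∈ Set.Icc (0 : ℝ) 1 then (f ⟨c, h⟩ : ℝ) else 0), ?_, ?_⟩
  · intro c hc
    obtain ⟨c', hc', rfl⟩ := Finset.mem_image.1 hc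
    split_ifs with h
    · exact hd (t := ⟨c', h⟩) (hs c' hc')
    · exact IsDyadic.zero
  · intro a b hab hav
    obtain ⟨n, d, h⟩ := hf (f.symm a) (f.symm b) (f.symm.monotone hab) (by
      intro c hc ⟨h1, h2⟩
      have hcI : c ∈ Set.Icc (0 : ℝ) 1 := ⟨(f.symm a).2.1.trans h1.le, h2.le.trans (f.symm b).2.2⟩
      refine hav _ (Finset.mem_image_of_mem _ hc) ?_
      rw [dif_pos hcI]
      have h1' : f.symm a < ⟨c, hcI⟩ := h1
      have h2' : (⟨c, hcI⟩ : I01) < f.symm b := h2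
      exact ⟨(f.symm_apply_lt).1 h1', (f.lt_symm_apply).1 h2'⟩)
    refine ⟨-n, -(2 ^ (-n) * d), fun t hat htb => ?_⟩
    have := h (f.symm t) (f.symm.monotone hat) (f.symm.monotone htb)
    rw [OrderIso.apply_symm_apply] at this
    change (f.symm t : ℝ) = _
    rw [this, zpow_neg]
    field_simp
    ring

theorem IsThompson.mul {f g : I01 ≃o I01} (hf : IsThompson f) (hg : IsThompson g) :
    IsThompson (f * g) := by
  classical
  have hd := @IsThompson.isDyadic _ hg.inv
  obtain ⟨s, hs, hf⟩ := hf
  obtain ⟨r, hr, hg⟩ := hg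
  refine ⟨r ∪ s.image (fun c => if h : c ∈ Set.Icc (0 : ℝ) 1 then (g⁻¹ ⟨c, h⟩ : ℝ) else 0), ?_, ?_⟩
  · intro c hc
    rcases Finset.mem_union.1 hc with hc | hc
    · exact hr c hc
    · obtain ⟨c', hc', rfl⟩ := Finset.mem_image.1 hc
      split_ifs with h
      · exact hd (t := ⟨c', h⟩) (hs c' hc')
      · exact IsDyadic.zero
  · intro a b hab hav
    obtain ⟨n, d, h⟩ := hg a b hab (fun c hc => hav c (Finset.mem_union_left _ hc))
    obtain ⟨m, e, h'⟩ := hf (g a) (g b) (g.monotone hab) (by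
      intro c hc ⟨h1, h2⟩
      have hcI : c ∈ Set.Icc (0 : ℝ) 1 := ⟨(g a).2.1.trans h1.le, h2.le.trans (g b).2.2⟩
      refine hav _ (Finset.mem_union_right _ (Finset.mem_image_of_mem _ hc)) ?_
      rw [dif_pos hcI]
      have h1' : g a < ⟨c, hcI⟩ := h1
      have h2' : (⟨c, hcI⟩ : I01) < g b := h2
      exact ⟨(g.lt_symm_apply).2 h1', (g.symm_apply_lt).2 h2'⟩)
    refine ⟨m + n, 2 ^ m * d + e, fun t hat htb => ?_⟩
    change (f (g t) : ℝ) = _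
    rw [h' (g t) (g.monotone hat) (g.monotone htb), h t hat htb, zpow_add₀ (by norm_num)]
    ring

/-- Thompson's group `F`, with composition of maps as multiplication. -/
def F : Subgroup (I01 ≃o I01) where
  carrier := {f | IsThompson f}
  one_mem' := IsThompson.one
  mul_mem' := IsThompson.mul
  inv_mem' := IsThompson.inv

/-- `F` acts on `[0,1]` by evaluation. -/
theorem smul_def (f : F) (t : I01) : f • t = f.1 t := rfl

/-! ### The generators -/

/-- The map `x₀` : `t ↦ t/2` on `[0,1/2]`, `t - 1/4` on `[1/2,3/4]`, `2t - 1` on `[3/4,1]`. -/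
def x0Fun (t : ℝ) : ℝ := if t ≤ 1 / 2 then t / 2 else if t ≤ 3 / 4 then t - 1 / 4 else 2 * t - 1

/-- The inverse of `x0Fun`. -/
def x0Inv (t : ℝ) : ℝ := if t ≤ 1 / 4 then 2 * t else if t ≤ 1 / 2 then t + 1 / 4 else (t + 1) / 2

/-- The map `x₁` : `t` on `[0,1/2]`, `t/2 + 1/4` on `[1/2,3/4]`, `t - 1/8` on `[3/4,7/8]`,
`2t - 1` on `[7/8,1]`. -/
def x1Fun (t : ℝ) : ℝ :=
  if t ≤ 1 / 2 then t else if t ≤ 3 / 4 then t / 2 + 1 / 4 else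
    if t ≤ 7 / 8 then t - 1 / 8 else 2 * t - 1

/-- The inverse of `x1Fun`. -/
def x1Inv (t : ℝ) : ℝ :=
  if t ≤ 1 / 2 then t else if t ≤ 5 / 8 then 2 * t - 1 / 2 else
    if t ≤ 3 / 4 then t + 1 / 8 else (t + 1) / 2

/-- An order automorphism of `[0,1]` from an increasing map and its inverse. -/
def mkIso (f g : ℝ → ℝ) (hf : ∀ t ∈ Set.Icc (0 : ℝ) 1, f t ∈ Set.Icc (0 : ℝ) 1)
    (hg : ∀ t ∈ Set.Icc (0 : ℝ) 1, g t ∈ Set.Icc (0 : ℝ) 1)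
    (hgf : ∀ t, g (f t) = t) (hfg : ∀ t, f (g t) = t) (hm : StrictMono f) : I01 ≃o I01 where
  toFun t := ⟨f t, hf t t.2⟩
  invFun t := ⟨g t, hg t t.2⟩
  left_inv t := Subtype.ext (hgf t)
  right_inv t := Subtype.ext (hfg t)
  map_rel_iff' := hm.le_iff_le

theorem x0_strictMono : StrictMono x0Fun := by
  intro a b h
  unfold x0Fun
  split_ifs <;> linarith

theorem x1_strictMono : StrictMono x1Fun := by
  intro a b h
  unfold x1Fun
  split_ifs <;> linarith

/-- `x₀` as an order automorphism of `[0,1]`. -/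
def x0Iso : I01 ≃o I01 :=
  mkIso x0Fun x0Inv
    (by rintro t ⟨h0, h1⟩; unfold x0Fun; constructor <;> split_ifs <;> linarith)
    (by rintro t ⟨h0, h1⟩; unfold x0Inv; constructor <;> split_ifs <;> linarith)
    (by intro t; unfold x0Inv x0Fun; split_ifs <;> linarith)
    (by intro t; unfold x0Inv x0Fun; split_ifs <;> linarith)
    x0_strictMono

/-- `x₁` as an order automorphism of `[0,1]`. -/
def x1Iso : I01 ≃o I01 :=
  mkIso x1Fun x1Inv
    (by rintro t ⟨h0, h1⟩; unfold x1Fun; constructor <;> split_ifs <;> linarith)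
    (by rintro t ⟨h0, h1⟩; unfold x1Inv; constructor <;> split_ifs <;> linarith)
    (by intro t; unfold x1Inv x1Fun; split_ifs <;> linarith)
    (by intro t; unfold x1Inv x1Fun; split_ifs <;> linarith)
    x1_strictMono

theorem x0_isThompson : IsThompson x0Iso := by
  classical
  refine ⟨{1 / 2, 3 / 4}, ?_, ?_⟩
  · intro c hc
    simp only [Finset.mem_insert, Finset.mem_singleton] at hc
    rcases hc with rfl | rfl
    · exact ⟨1, 1, by norm_num⟩
    · exact ⟨3, 2, by norm_num⟩
  · intro a b hab hav
    have h1 := hav (1 / 2) (by simp)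
    have h2 := hav (3 / 4) (by simp)
    have hab' : (a : ℝ) ≤ b := hab
    have hE : ∀ t : I01, (x0Iso t : ℝ) = x0Fun t := fun _ => rfl
    rcases le_or_gt (b : ℝ) (1 / 2) with hb | hb
    · refine ⟨-1, 0, fun t _ htb => ?_⟩
      have : (t : ℝ) ≤ b := htb
      rw [hE, x0Fun, if_pos (by linarith)]
      norm_num
      ring
    have ha : 1 / 2 ≤ (a : ℝ) := by
      by_contra h
      exact h1 ⟨by linarith, hb⟩
    rcases le_or_gt (b : ℝ) (3 / 4) with hb' | hb'
    · refine ⟨0, -1 / 4, fun t hat htb => ?_⟩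
      have h3 : (t : ℝ) ≤ b := htb
      have h4 : (a : ℝ) ≤ t := hat
      rw [hE, x0Fun, zpow_zero]
      split_ifs <;> linarith
    have ha' : 3 / 4 ≤ (a : ℝ) := by
      by_contra h
      exact h2 ⟨by linarith, hb'⟩
    refine ⟨1, -1, fun t hat htb => ?_⟩
    have h3 : (t : ℝ) ≤ b := htb
    have h4 : (a : ℝ) ≤ t := hat
    rw [hE, x0Fun, zpow_one]
    split_ifs <;> linarith

theorem x1_isThompson : IsThompson x1Iso := by
  classical
  refine ⟨{1 / 2, 3 / 4, 7 / 8}, ?_, ?_⟩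
  · intro c hc
    simp only [Finset.mem_insert, Finset.mem_singleton] at hc
    rcases hc with rfl | rfl | rfl
    · exact ⟨1, 1, by norm_num⟩
    · exact ⟨3, 2, by norm_num⟩
    · exact ⟨7, 3, by norm_num⟩
  · intro a b hab hav
    have h1 := hav (1 / 2) (by simp)
    have h2 := hav (3 / 4) (by simp)
    have h2' := hav (7 / 8) (by simp)
    have hab' : (a : ℝ) ≤ b := hab
    have hE : ∀ t : I01, (x1Iso t : ℝ) = x1Fun t := fun _ => rfl
    rcases le_or_gt (b : ℝ) (1 / 2) with hb | hb
    · refine ⟨0, 0, fun t _ htb => ?_⟩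
      have : (t : ℝ) ≤ b := htb
      rw [hE, x1Fun, if_pos (by linarith), zpow_zero]
      ring
    have ha : 1 / 2 ≤ (a : ℝ) := by
      by_contra h
      exact h1 ⟨by linarith, hb⟩
    rcases le_or_gt (b : ℝ) (3 / 4) with hb' | hb'
    · refine ⟨-1, 1 / 4, fun t hat htb => ?_⟩
      have h3 : (t : ℝ) ≤ b := htb
      have h4 : (a : ℝ) ≤ t := hat
      rw [hE, x1Fun, zpow_neg_one]
      split_ifs <;> linarith
    have ha' : 3 / 4 ≤ (a : ℝ) := by
      by_contra h
      exact h2 ⟨by linarith, hb'⟩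
    rcases le_or_gt (b : ℝ) (7 / 8) with hb'' | hb''
    · refine ⟨0, -1 / 8, fun t hat htb => ?_⟩
      have h3 : (t : ℝ) ≤ b := htb
      have h4 : (a : ℝ) ≤ t := hat
      rw [hE, x1Fun, zpow_zero]
      split_ifs <;> linarith
    have ha'' : 7 / 8 ≤ (a : ℝ) := by
      by_contra h
      exact h2' ⟨by linarith, hb''⟩
    refine ⟨1, -1, fun t hat htb => ?_⟩
    have h3 : (t : ℝ) ≤ b := htb
    have h4 : (a : ℝ) ≤ t := hat
    rw [hE, x1Fun, zpow_one]
    split_ifs <;> linarith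

/-- The standard generators `x₀`, `x₁` of `F`. -/
def gen : Fin 2 → F := ![⟨x0Iso, x0_isThompson⟩, ⟨x1Iso, x1_isThompson⟩]

theorem gen_zero_smul (t : I01) : ((gen 0 • t : I01) : ℝ) = x0Fun t := rfl

theorem gen_one_smul (t : I01) : ((gen 1 • t : I01) : ℝ) = x1Fun t := rfl

/-! ## The standard action of `F` on the Cantor set -/

/-- The Cantor set `{0,1}^ω` of infinite binary words, with the product topology. -/
abbrev Cantor : Type := ℕ → Fin 2

/-- The point `0.w₀w₁w₂…` of `[0,1]` with binary expansion `w`. -/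
def value (w : Cantor) : I01 := ⟨Real.ofDigits w, Real.ofDigits_nonneg w, Real.ofDigits_le_one w⟩

/-- The word `w` ends in `111…`. -/
def EndsInOnes (w : Cantor) : Prop := ∃ N, ∀ n, N ≤ n → w n = 1

/-- Swap the letters `0` and `1`. -/
def flipWord (w : Cantor) : Cantor := fun n => Fin.rev (w n)

/-- The binary expansion of `t ∈ [0,1)` which does not end in `111…`. -/
def upperExpansion (t : ℝ) : Cantor := Real.digits t 2

/-- The binary expansion of `t ∈ (0,1]` which does not end in `000…`. -/
def lowerExpansion (t : ℝ) : Cantor := flipWord (upperExpansion (1 - t))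

open Classical in
/-- The map induced by `f` on `{0,1}^ω`: the word `w` goes to the binary expansion of the image
under `f` of the point `0.w`; if this point is dyadic, it has two expansions, and the
one which ends in `111…` is taken exactly when `w` ends in `111…`. -/
def cantorMap (f : F) (w : Cantor) : Cantor :=
  if EndsInOnes w then lowerExpansion (f • value w : I01) else upperExpansion (f • value w : I01)

theorem flipWord_flipWord (w : Cantor) : flipWord (flipWord w) = w := by
  funext n
  simp [flipWord]

theorem ofDigits_cons (w : Cantor) :
    Real.ofDigits w = ((w 0 : ℕ) : ℝ) / 2 + Real.ofDigits (fun i => w (i + 1)) / 2 := by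
  rw [Real.ofDigits_eq_sum_add_ofDigits w 1]
  simp [Real.ofDigitsTerm]
  ring

theorem rev_val (a : Fin 2) : ((Fin.rev a : Fin 2) : ℕ) + (a : ℕ) = 1 := by
  fin_cases a <;> rfl

theorem ofDigits_flipWord (w : Cantor) : Real.ofDigits (flipWord w) = 1 - Real.ofDigits w := by
  have h1 := Real.ofDigits_const_last_eq_one 1
  rw [eq_sub_iff_add_eq, ← h1]
  unfold Real.ofDigits
  rw [← Real.summable_ofDigitsTerm.tsum_add Real.summable_ofDigitsTerm]
  congr 1
  funext n
  have := rev_val (w n)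
  have h' : (((Fin.rev (w n) : Fin 2) : ℕ) : ℝ) + ((w n : ℕ) : ℝ) = 1 := by exact_mod_cast this
  simp only [Real.ofDigitsTerm, flipWord, ← add_mul, h']
  simp

theorem eq_one_of_ofDigits_eq_one {w : Cantor} (h : Real.ofDigits w = 1) (n : ℕ) : w n = 1 := by
  have key : ∀ v : Cantor, Real.ofDigits v = 1 →
      v 0 = 1 ∧ Real.ofDigits (fun i => v (i + 1)) = 1 := by
    intro v hv
    rw [ofDigits_cons] at hv
    have hle := Real.ofDigits_le_one (fun i => v (i + 1))
    have hv0 : v 0 = 0 ∨ v 0 = 1 := by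
      generalize v 0 = a
      fin_cases a <;> simp
    rcases hv0 with h0 | h0
    · rw [h0] at hv
      simp at hv
      linarith
    · refine ⟨h0, ?_⟩
      rw [h0] at hv
      simp at hv
      linarith
  induction n generalizing w with
  | zero => exact (key w h).1
  | succ n ih => exact ih (key w h).2

theorem ofDigits_ones {w : Cantor} (h : ∀ n, w n = 1) : Real.ofDigits w = 1 := by
  have h1 := Real.ofDigits_const_last_eq_one 1
  rw [← h1]
  congr 1
  funext n
  exact h n

/-- The integer with binary digits `w₀ … w_{n-1}`. -/
theorem exists_partial (w : Cantor) (n : ℕ) :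
    ∃ N : ℕ, (2 : ℝ) ^ n * Real.ofDigits w = N + Real.ofDigits (fun i => w (i + n)) := by
  induction n with
  | zero => exact ⟨0, by simp⟩
  | succ n ih =>
    obtain ⟨N, hN⟩ := ih
    refine ⟨2 * N + (w n : ℕ), ?_⟩
    have := ofDigits_cons (fun i => w (i + n))
    simp only [zero_add] at this
    have h2 : (fun i => w (i + 1 + n)) = fun i => w (i + (n + 1)) := by
      funext i
      congr 1
      ring
    rw [h2] at this
    rw [pow_succ', mul_assoc, hN, this]
    push_cast
    ring

theorem upperExpansion_ofDigits {w : Cantor} (hw : ¬ EndsInOnes w) :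
    upperExpansion (Real.ofDigits w) = w := by
  funext n
  obtain ⟨N, hN⟩ := exists_partial w n
  have h1 := ofDigits_cons (fun i => w (i + n))
  simp only [zero_add] at h1
  have hlt : Real.ofDigits (fun i => w (i + 1 + n)) < 1 := by
    refine lt_of_le_of_ne (Real.ofDigits_le_one _) fun h => hw ⟨n + 1, fun m hm => ?_⟩
    have := eq_one_of_ofDigits_eq_one h (m - (n + 1))
    rwa [show m - (n + 1) + 1 + n = m by omega] at this
  have hnn := Real.ofDigits_nonneg (fun i => w (i + 1 + n))
  have hfl : ⌊Real.ofDigits w * (2 : ℝ) ^ (n + 1)⌋₊ = 2 * N + (w n : ℕ) := by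
    rw [Nat.floor_eq_iff (mul_nonneg (Real.ofDigits_nonneg _) (by positivity))]
    have : Real.ofDigits w * (2 : ℝ) ^ (n + 1)
        = 2 * N + ((w n : ℕ) : ℝ) + Real.ofDigits (fun i => w (i + 1 + n)) := by
      rw [mul_comm, pow_succ', mul_assoc, hN, h1]
      ring
    rw [this]
    push_cast
    constructor <;> linarith
  unfold upperExpansion Real.digits
  push_cast
  rw [hfl]
  apply Fin.ext
  rw [Fin.val_ofNat]
  have := (w n).isLt
  omega

theorem not_endsInOnes_flipWord {w : Cantor} (hw : EndsInOnes w) : ¬ EndsInOnes (flipWord w) := by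
  rintro ⟨M, hM⟩
  obtain ⟨N, hN⟩ := hw
  have h1 := hM (max M N) (le_max_left _ _)
  have h2 := hN (max M N) (le_max_right _ _)
  simp only [flipWord, h2] at h1
  exact absurd h1 (by decide)

theorem lowerExpansion_ofDigits {w : Cantor} (hw : EndsInOnes w) :
    lowerExpansion (Real.ofDigits w) = w := by
  unfold lowerExpansion
  rw [← ofDigits_flipWord, upperExpansion_ofDigits (not_endsInOnes_flipWord hw), flipWord_flipWord]

theorem ofDigits_upperExpansion {t : ℝ} (ht : t ∈ Set.Ico (0 : ℝ) 1) :
    Real.ofDigits (upperExpansion t) = t := Real.ofDigits_digits (by norm_num) ht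

theorem ofDigits_lowerExpansion {t : ℝ} (ht : t ∈ Set.Ioc (0 : ℝ) 1) :
    Real.ofDigits (lowerExpansion t) = t := by
  unfold lowerExpansion
  rw [ofDigits_flipWord, ofDigits_upperExpansion ⟨by linarith [ht.2], by linarith [ht.1]⟩]
  ring

theorem upperExpansion_not_endsInOnes {t : ℝ} (ht : t ∈ Set.Ico (0 : ℝ) 1) :
    ¬ EndsInOnes (upperExpansion t) := by
  rintro ⟨N, hN⟩
  have h1 := ofDigits_upperExpansion ht
  have h2 := Real.ofDigits_eq_sum_add_ofDigits (upperExpansion t) N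
  have h3 := Real.ofDigits_digits_sum_eq (b := 2) ht N
  rw [h1, ofDigits_ones (fun n => hN _ (Nat.le_add_left _ _))] at h2
  have h4 := Nat.lt_floor_add_one ((2 : ℝ) ^ N * t)
  have h5 : (2 : ℝ) ^ N * t = ⌊(2 : ℝ) ^ N * t⌋₊ + 1 := by
    push_cast at h3
    rw [← h3]
    conv_lhs => rw [h2]
    unfold upperExpansion
    push_cast
    field_simp
  linarith

theorem lowerExpansion_endsInOnes {t : ℝ} (ht : t ≤ 1) (hd : IsDyadic t) :
    EndsInOnes (lowerExpansion t) := by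
  obtain ⟨k, n, hk⟩ := IsDyadic.one.sub hd
  have hk0 : 0 ≤ k := by
    have : (0 : ℝ) ≤ k / 2 ^ n := by rw [← hk]; linarith
    rw [le_div_iff₀ (by positivity), zero_mul] at this
    exact_mod_cast this
  lift k to ℕ using hk0
  refine ⟨n, fun m hm => ?_⟩
  unfold lowerExpansion flipWord upperExpansion Real.digits
  rw [hk]
  have : ((k : ℤ) : ℝ) / 2 ^ n * ((2 : ℕ) : ℝ) ^ (m + 1) = ((2 * (k * 2 ^ (m - n)) : ℕ) : ℝ) := by
    obtain ⟨d, rfl⟩ := Nat.exists_eq_add_of_le hm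
    rw [Nat.add_sub_cancel_left]
    push_cast
    rw [pow_succ, pow_add]
    field_simp
  rw [this, Nat.floor_natCast]
  have h0 : Fin.ofNat 2 (2 * (k * 2 ^ (m - n))) = 0 := by
    apply Fin.ext
    simp
  rw [h0]
  rfl

theorem EndsInOnes.isDyadic {w : Cantor} (hw : EndsInOnes w) : IsDyadic (value w : ℝ) := by
  obtain ⟨N, hN⟩ := hw
  obtain ⟨K, hK⟩ := exists_partial w N
  rw [ofDigits_ones (fun n => hN _ (Nat.le_add_left _ _))] at hK
  refine ⟨K + 1, N, ?_⟩
  rw [eq_div_iff (by positivity), mul_comm]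
  push_cast
  exact hK

theorem EndsInOnes.value_pos {w : Cantor} (hw : EndsInOnes w) : ⊥ < value w := by
  refine bot_lt_iff_ne_bot.2 fun h => not_endsInOnes_flipWord hw ⟨0, fun n _ => ?_⟩
  refine eq_one_of_ofDigits_eq_one ?_ n
  rw [ofDigits_flipWord]
  have : Real.ofDigits w = 0 := congrArg Subtype.val h
  rw [this, sub_zero]

theorem value_lt_top {w : Cantor} (hw : ¬ EndsInOnes w) : value w < ⊤ := by
  refine lt_top_iff_ne_top.2 fun h => hw ⟨0, fun n _ => ?_⟩
  exact eq_one_of_ofDigits_eq_one (congrArg Subtype.val h) n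

theorem cantorMap_spec (f : F) (w : Cantor) :
    value (cantorMap f w) = f • value w ∧ (EndsInOnes (cantorMap f w) ↔ EndsInOnes w) := by
  unfold cantorMap
  split_ifs with hw
  · have hpos : (⊥ : I01) < f • value w := by
      have := f.1.strictMono hw.value_pos
      rwa [f.1.map_bot] at this
    have hd : IsDyadic ((f • value w : I01) : ℝ) := IsThompson.isDyadic f.2 hw.isDyadic
    refine ⟨Subtype.ext (ofDigits_lowerExpansion ⟨hpos, (f • value w).2.2⟩), ?_⟩
    exact iff_of_true (lowerExpansion_endsInOnes (f • value w).2.2 hd) hw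
  · have hlt : f • value w < (⊤ : I01) := by
      have := f.1.strictMono (value_lt_top hw)
      rwa [f.1.map_top] at this
    have hI : ((f • value w : I01) : ℝ) ∈ Set.Ico (0 : ℝ) 1 := ⟨(f • value w).2.1, hlt⟩
    exact ⟨Subtype.ext (ofDigits_upperExpansion hI),
      iff_of_false (upperExpansion_not_endsInOnes hI) hw⟩

theorem cantor_ext {v w : Cantor} (h : value v = value w) (h' : EndsInOnes v ↔ EndsInOnes w) :
    v = w := by
  have h1 : Real.ofDigits v = Real.ofDigits w := congrArg Subtype.val h
  by_cases hw : EndsInOnes w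
  · rw [← lowerExpansion_ofDigits hw, ← lowerExpansion_ofDigits (h'.2 hw), h1]
  · rw [← upperExpansion_ofDigits hw, ← upperExpansion_ofDigits (fun hv => hw (h'.1 hv)), h1]

/-- The standard action of `F` on `{0,1}^ω`. -/
instance : MulAction F Cantor where
  smul := cantorMap
  one_smul w := cantor_ext ((cantorMap_spec 1 w).1.trans (one_smul _ _)) (cantorMap_spec 1 w).2
  mul_smul f g w := by
    refine cantor_ext ?_ ?_
    · refine (cantorMap_spec (f * g) w).1.trans ?_
      refine Eq.trans ?_ (cantorMap_spec f (cantorMap g w)).1.symm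
      rw [(cantorMap_spec g w).1, mul_smul]
    · exact (cantorMap_spec (f * g) w).2.trans
        ((cantorMap_spec f (cantorMap g w)).2.trans (cantorMap_spec g w).2).symm

theorem cantor_smul_def (f : F) (w : Cantor) : f • w = cantorMap f w := rfl

/-! ## Pointed marked graphs and their topology -/

/-- A pointed marked graph: a connected oriented graph with a selected vertex whose arrows are
labeled by the two symbols `x₀`, `x₁` (encoded as `0`, `1`), regular in the sense that for each
label every vertex has exactly one outgoing and exactly one incoming arrow with this label.
The arrow with label `s` starting at `v` ends at `step s v`. -/
structure PointedGraph where
  /-- the vertices -/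
  V : Type
  /-- the end of the arrow with a given label and a given beginning -/
  step : Fin 2 → Equiv.Perm V
  /-- the selected vertex -/
  base : V
  connected : ∀ v, Relation.EqvGen (fun u w => ∃ s, step s u = w) base v

namespace PointedGraph

/-- There is an arrow from `u` to `v` with label `s`. -/
def Arrow (Γ : PointedGraph) (s : Fin 2) (u v : Γ.V) : Prop := Γ.step s u = v

/-- The set of vertices of the ball of radius `n` centered at the selected vertex: the vertices
joined with it by a path of at most `n` arrows, traversed in either direction. -/
def ball (Γ : PointedGraph) : ℕ → Set Γ.V
  | 0 => {Γ.base}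
  | n + 1 => Γ.ball n ∪ {v | ∃ u ∈ Γ.ball n, ∃ s, Γ.Arrow s u v ∨ Γ.Arrow s v u}

theorem base_mem_ball (Γ : PointedGraph) (n : ℕ) : Γ.base ∈ Γ.ball n := by
  induction n with
  | zero => exact rfl
  | succ n ih => exact Or.inl ih

/-- The balls of radius `n` centered at the selected vertices, as induced subgraphs, are
isomorphic as pointed marked graphs. -/
def BallIso (n : ℕ) (Γ Δ : PointedGraph) : Prop :=
  ∃ e : Γ.ball n ≃ Δ.ball n,
    e ⟨Γ.base, Γ.base_mem_ball n⟩ = ⟨Δ.base, Δ.base_mem_ball n⟩ ∧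
    ∀ (s : Fin 2) (u v : Γ.ball n), Γ.Arrow s u v ↔ Δ.Arrow s (e u) (e v)

open Classical in
/-- The distance `2⁻ⁿ`, where `n` is the largest integer such that the balls of radius `n`
are isomorphic; it is `0` if all balls are isomorphic, and `1` if no balls are. -/
def gdist (Γ Δ : PointedGraph) : ℝ := ⨅ n : ℕ, if BallIso n Γ Δ then (1 / 2) ^ n else 1

/-- Isomorphism of pointed marked graphs. -/
def Iso (Γ Δ : PointedGraph) : Prop :=
  ∃ e : Γ.V ≃ Δ.V, e Γ.base = Δ.base ∧ ∀ s u v, Γ.Arrow s u v ↔ Δ.Arrow s (e u) (e v)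

instance setoid : Setoid PointedGraph where
  r := Iso
  iseqv :=
    { refl := fun _ => ⟨Equiv.refl _, rfl, fun _ _ _ => Iff.rfl⟩
      symm := by
        rintro Γ Δ ⟨e, hb, he⟩
        refine ⟨e.symm, by rw [← hb, e.symm_apply_apply], fun s u v => ?_⟩
        rw [he, e.apply_symm_apply, e.apply_symm_apply]
      trans := by
        rintro Γ Δ Θ ⟨e, hb, he⟩ ⟨e', hb', he'⟩
        refine ⟨e.trans e', by simp [hb, hb'], fun s u v => ?_⟩
        rw [he, he']
        rfl }

end PointedGraph

/-- The space of pointed marked graphs, considered up to isomorphism. -/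
def GraphSpace : Type 1 := Quotient PointedGraph.setoid

/-- The isomorphism class of a pointed marked graph. -/
def GraphSpace.mk (Γ : PointedGraph) : GraphSpace := Quotient.mk PointedGraph.setoid Γ

/-- The pointed graphs topology: the topology of the distance `gdist`. -/
instance : TopologicalSpace GraphSpace where
  IsOpen U := ∀ Γ, GraphSpace.mk Γ ∈ U →
    ∃ ε > 0, ∀ Δ, PointedGraph.gdist Γ Δ < ε → GraphSpace.mk Δ ∈ U
  isOpen_univ := fun _ _ => ⟨1, one_pos, fun _ _ => trivial⟩
  isOpen_inter := by
    rintro U W hU hW Γ ⟨h1, h2⟩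
    obtain ⟨ε, hε, h⟩ := hU Γ h1
    obtain ⟨δ, hδ, h'⟩ := hW Γ h2
    exact ⟨min ε δ, lt_min hε hδ, fun Δ hΔ =>
      ⟨h Δ (hΔ.trans_le (min_le_left _ _)), h' Δ (hΔ.trans_le (min_le_right _ _))⟩⟩
  isOpen_sUnion := by
    rintro S hS Γ ⟨U, hU, hΓ⟩
    obtain ⟨ε, hε, h⟩ := hS U hU Γ hΓ
    exact ⟨ε, hε, fun Δ hΔ => ⟨U, hU, h Δ hΔ⟩⟩

/-! ## Schreier graphs of dyadic rationals and the Schreier dynamical system -/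

/-- The point `1/2` of `[0,1]`. -/
def half : I01 := ⟨1 / 2, by norm_num, by norm_num⟩

/-- The orbit of `1/2` under `F`, that is, the set of dyadic rationals in `(0,1)`. -/
abbrev Dyadics : Type := MulAction.orbit F half

theorem inv_gen_zero_smul (t : I01) : (((gen 0)⁻¹ • t : I01) : ℝ) = x0Inv t := rfl

theorem inv_gen_one_smul (t : I01) : (((gen 1)⁻¹ • t : I01) : ℝ) = x1Inv t := rfl

theorem gen_mem (s : Fin 2) : gen s ∈ Subgroup.closure (Set.range gen) :=
  Subgroup.subset_closure ⟨s, rfl⟩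

theorem reach_step (t : I01) (h0 : 0 < (t : ℝ)) (h1 : (t : ℝ) < 1) (h2 : (t : ℝ) ≠ 1 / 2)
    (h3 : (t : ℝ) ≠ 3 / 4) :
    ∃ g ∈ Subgroup.closure (Set.range gen), ∃ j : ℤ, ((g • t : I01) : ℝ) = 2 * t - j / 4 ∧
      0 < 2 * (t : ℝ) - j / 4 ∧ 2 * (t : ℝ) - j / 4 < 1 := by
  have hg0 := gen_mem 0
  have hg1 := gen_mem 1
  rcases le_or_gt (t : ℝ) (1 / 4) with c1 | c1
  · refine ⟨_, inv_mem hg0, 0, ?_, ?_, ?_⟩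
    · rw [inv_gen_zero_smul, x0Inv, if_pos c1, Int.cast_zero]; ring
    · rw [Int.cast_zero]; linarith
    · rw [Int.cast_zero]; linarith
  have e1 : (t : ℝ) < 1 / 2 → (((gen 0)⁻¹ • t : I01) : ℝ) = t + 1 / 4 := fun c => by
    rw [inv_gen_zero_smul, x0Inv, if_neg (by linarith), if_pos (by linarith)]
  rcases le_or_gt (t : ℝ) (3 / 8) with c2 | c2
  · refine ⟨_, mul_mem (inv_mem hg1) (inv_mem hg0), 0, ?_, ?_, ?_⟩
    · rw [mul_smul, inv_gen_one_smul, e1 (by linarith), x1Inv, if_neg (by linarith),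
        if_pos (by linarith), Int.cast_zero]
      ring
    · rw [Int.cast_zero]; linarith
    · rw [Int.cast_zero]; linarith
  rcases lt_or_gt_of_ne h2 with c3 | c3
  · refine ⟨_, mul_mem hg0 (mul_mem (inv_mem hg1) (inv_mem hg0)), 1, ?_, ?_, ?_⟩
    · rw [mul_smul, mul_smul, gen_zero_smul, inv_gen_one_smul, e1 (by linarith), x1Inv,
        if_neg (by linarith), if_neg (by linarith), if_pos (by linarith), x0Fun,
        if_neg (by linarith), if_neg (by linarith), Int.cast_one]
      ring
    · rw [Int.cast_one]; linarith
    · rw [Int.cast_one]; linarith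
  rcases le_or_gt (t : ℝ) (5 / 8) with c4 | c4
  · refine ⟨_, inv_mem hg1, 2, ?_, ?_, ?_⟩
    · rw [inv_gen_one_smul, x1Inv, if_neg (by linarith), if_pos c4, Int.cast_ofNat]
      ring
    · rw [Int.cast_ofNat]; linarith
    · rw [Int.cast_ofNat]; linarith
  rcases lt_or_gt_of_ne h3 with c5 | c5
  · refine ⟨_, mul_mem hg0 (inv_mem hg1), 3, ?_, ?_, ?_⟩
    · rw [mul_smul, gen_zero_smul, inv_gen_one_smul, x1Inv, if_neg (by linarith),
        if_neg (by linarith), if_pos (by linarith), x0Fun, if_neg (by linarith),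
        if_neg (by linarith), Int.cast_ofNat]
      ring
    · rw [Int.cast_ofNat]; linarith
    · rw [Int.cast_ofNat]; linarith
  · refine ⟨_, hg0, 4, ?_, ?_, ?_⟩
    · rw [gen_zero_smul, x0Fun, if_neg (by linarith), if_neg (by linarith), Int.cast_ofNat]
      ring
    · rw [Int.cast_ofNat]; linarith
    · rw [Int.cast_ofNat]; linarith

theorem reach_half (n : ℕ) (t : I01) (h0 : 0 < (t : ℝ)) (h1 : (t : ℝ) < 1)
    (ht : ∃ k : ℤ, (t : ℝ) = k / 2 ^ (n + 2)) :
    ∃ g ∈ Subgroup.closure (Set.range gen), g • t = half := by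
  by_cases h2 : (t : ℝ) = 1 / 2
  · exact ⟨1, one_mem _, Subtype.ext (by rw [one_smul, h2]; rfl)⟩
  by_cases h3 : (t : ℝ) = 3 / 4
  · refine ⟨_, gen_mem 0, Subtype.ext ?_⟩
    rw [gen_zero_smul, h3]
    norm_num [x0Fun, half]
  obtain ⟨k, hk⟩ := ht
  induction n generalizing t k with
  | zero =>
    have hk' : (t : ℝ) = k / 4 := by rw [hk]; norm_num
    have hk0 : (0 : ℝ) < k := by linarith
    have hk4 : (k : ℝ) < 4 := by linarith
    have a : 0 < k := by exact_mod_cast hk0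
    have b : k < 4 := by exact_mod_cast hk4
    have hc : k = 1 ∨ k = 2 ∨ k = 3 := by omega
    rcases hc with rfl | rfl | rfl
    · refine ⟨_, inv_mem (gen_mem 0), Subtype.ext ?_⟩
      rw [inv_gen_zero_smul, hk']
      norm_num [x0Inv, half]
    · exact absurd (hk'.trans (by norm_num)) h2
    · exact absurd (hk'.trans (by norm_num)) h3
  | succ n ih =>
    obtain ⟨g, hg, j, hj, hj0, hj1⟩ := reach_step t h0 h1 h2 h3
    by_cases h2' : ((g • t : I01) : ℝ) = 1 / 2
    · exact ⟨g, hg, Subtype.ext h2'⟩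
    by_cases h3' : ((g • t : I01) : ℝ) = 3 / 4
    · refine ⟨_, mul_mem (gen_mem 0) hg, Subtype.ext ?_⟩
      rw [mul_smul, gen_zero_smul, h3']
      norm_num [x0Fun, half]
    obtain ⟨g', hg', h⟩ := ih (g • t) (hj ▸ hj0) (hj ▸ hj1) h2' h3' (k - j * 2 ^ n) (by
      rw [hj, hk]
      push_cast
      rw [show n + 1 + 2 = n + 2 + 1 from rfl, pow_succ (2 : ℝ) (n + 2), pow_add]
      field_simp
      ring)
    exact ⟨g' * g, mul_mem hg' hg, by rw [mul_smul, h]⟩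

theorem mem_orbit_half_iff (t : I01) :
    t ∈ MulAction.orbit F half ↔ IsDyadic (t : ℝ) ∧ 0 < (t : ℝ) ∧ (t : ℝ) < 1 := by
  constructor
  · rintro ⟨f, rfl⟩
    refine ⟨IsThompson.isDyadic f.2 ⟨1, 1, by norm_num [half]⟩, ?_, ?_⟩
    · have : f.1 ⊥ < f.1 half := f.1.strictMono (show (0 : ℝ) < 1 / 2 by norm_num)
      rw [f.1.map_bot] at this
      exact this
    · have : f.1 half < f.1 ⊤ := f.1.strictMono (show (1 / 2 : ℝ) < 1 by norm_num)
      rw [f.1.map_top] at this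
      exact this
  · rintro ⟨⟨k, n, hk⟩, h0, h1⟩
    obtain ⟨g, -, hg⟩ := reach_half n t h0 h1 ⟨k * 4, by
      rw [hk]; push_cast; rw [pow_add]; field_simp; norm_num⟩
    exact ⟨g⁻¹, by simp only; rw [← hg, inv_smul_smul]⟩

theorem dyadics_connected (q v : Dyadics) :
    Relation.EqvGen (fun u w : Dyadics => ∃ s, MulAction.toPerm (gen s) u = w) q v := by
  have key : ∀ g ∈ Subgroup.closure (Set.range gen), ∀ u : Dyadics,
      Relation.EqvGen (fun u w : Dyadics => ∃ s, MulAction.toPerm (gen s) u = w) u (g • u) := by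
    intro g hg
    induction hg using Subgroup.closure_induction with
    | mem x hx =>
      obtain ⟨s, rfl⟩ := hx
      exact fun u => .rel _ _ ⟨s, rfl⟩
    | one => exact fun u => by rw [one_smul]; exact .refl u
    | mul x y _ _ hx hy =>
      intro u
      rw [mul_smul]
      exact .trans _ _ _ (hy u) (hx _)
    | inv x _ hx =>
      intro u
      have := hx (x⁻¹ • u)
      rw [smul_inv_smul] at this
      exact .symm _ _ this
  have toHalf : ∀ u : Dyadics,
      Relation.EqvGen (fun u w : Dyadics => ∃ s, MulAction.toPerm (gen s) u = w) u
        ⟨half, MulAction.mem_orbit_self half⟩ := by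
    intro u
    obtain ⟨⟨k, n, hk⟩, h0, h1⟩ := (mem_orbit_half_iff u.1).1 u.2
    obtain ⟨g, hg, h⟩ := reach_half n u.1 h0 h1 ⟨k * 4, by
      rw [hk]; push_cast; rw [pow_add]; field_simp; norm_num⟩
    have := key g hg u
    rwa [show g • u = ⟨half, MulAction.mem_orbit_self half⟩ from Subtype.ext h] at this
  exact .trans _ _ _ (toHalf q) (.symm _ _ (toHalf v))

/-- The pointed Schreier graph `Γ_q` of a dyadic rational `q`: the vertices are the points of the
orbit of `q`, an arrow labeled by `x_s` goes from each vertex to its image under `x_s`, and the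
selected vertex is `q`. -/
def schreierGraph (q : Dyadics) : PointedGraph where
  V := Dyadics
  step s := MulAction.toPerm (gen s)
  base := q
  connected := dyadics_connected q

/-- The closure of the set of all pointed Schreier graphs of dyadic rationals. -/
def SchreierClosure : Set GraphSpace :=
  closure (Set.range fun q : Dyadics => GraphSpace.mk (schreierGraph q))

/-- The Schreier graph of a dyadic rational as a point of the closure. -/
def toClosure (q : Dyadics) : SchreierClosure :=
  ⟨GraphSpace.mk (schreierGraph q), subset_closure ⟨q, rfl⟩⟩

/-- An action of `F` on the closure is the *Schreier dynamical system* if `F` acts by continuous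
maps and acts on the Schreier graphs of dyadic rationals by shifting the selected vertex: a path
whose consecutive labels spell `f` leads from the vertex `q` to the vertex `f(q)`. -/
def IsSchreierSystem (A : MulAction F SchreierClosure) : Prop :=
  (∀ f : F, Continuous (A.smul f)) ∧
    ∀ (f : F) (q : Dyadics), A.smul f (toClosure q) = toClosure (f • q)

/-- The perfect kernel `𝒟` of the closure. -/
def kernelD : Set SchreierClosure := CantorBendixson.perfectKernel Set.univ

/-- The label of a dyadic rational: its binary expansion with finitely many digits `1`. -/
def dyadicLabel (q : Dyadics) : Cantor := upperExpansion (q : I01)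

/-- The word `w` is the label of the selected vertex of the graph `Γ`: the labels of dyadic
rationals `q` converge to `w` as the Schreier graphs of `q` converge to `Γ`. -/
def IsBaseLabel (Γ : SchreierClosure) (w : Cantor) : Prop :=
  Filter.Tendsto dyadicLabel (Filter.comap toClosure (𝓝 Γ)) (𝓝 w)

end

end ThompsonSchreier

/-!
A pointed marked graph is determined up to isomorphism by the stabilizer of its selected vertex in
the free group on the two labels, and two graphs are close exactly when these stabilizers agree on
all short words (`GraphSpace.isInducing_code`). So the space of graphs is the compact Hausdorff space
of subgroups of the free group, and `Γ_q` corresponds to the stabilizer of the binary expansion of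
`q` in the Cantor set.

An element `f` of `F` is affine on cylinders of large depth. Hence near a word `w` it is either the
identity or has no fixed point different from `w` (`eventually_fixed_or_eventually_moved`).
Consequently, as the labels of dyadic rationals `q` converge to `w` without being equal to `w`, the
stabilizers converge to the group `germStab w` of all words acting as the identity near `w`, and
`w ↦ germStab w` is continuous. By compactness of the Cantor set every point of the closure is some
`Γ_q` or one of these limits `germPoint w` (`eq_toClosure_or_eq_germPoint`).

The map `germPoint` is injective: two words are separated by a dyadic cut, which can be moved to
`1/2`, and `x₁` is the identity to the left of `1/2` but nowhere locally the identity to the right of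
it (`germStab_injective`). Each `Γ_q` is isolated in the closure, because some word fixes `q` and no
point of `[0,1]` other than `0`, `q`, `1` (`exists_isolating`), so that among the subgroups in the
closure only the stabilizer of `q` contains it. Therefore the perfect kernel is the image of
`germPoint`, a copy of the Cantor set.

The action of `F` on the closure is defined by its actions on dyadic rationals and on the Cantor set.
It is continuous since a sequence of graphs `Γ_q` tends to `germPoint w` only if the labels tend to
`w` (`comap_toClosure_nhds_le`) and `F` acts continuously on the Cantor set; uniqueness holds since
the graphs `Γ_q` are dense.
-/

namespace ThompsonSchreier

open Filter

/-! ### The space of pointed marked graphs as a space of subgroups of the free group -/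

/-- Two families that identify the same indices have canonically bijective ranges. -/
theorem exists_equiv_of_surjective {ι α β : Type*} {p : ι → α} {p' : ι → β}
    (hp : Function.Surjective p) (hp' : Function.Surjective p')
    (h : ∀ i j, p i = p j ↔ p' i = p' j) : ∃ e : α ≃ β, ∀ i, e (p i) = p' i := by
  refine ⟨Equiv.ofBijective (fun a => p' (Function.surjInv hp a)) ⟨fun a b hab => ?_, fun b => ?_⟩,
    fun i => (h _ _).1 (Function.surjInv_eq hp _)⟩
  · have := (h _ _).2 hab
    rwa [Function.surjInv_eq hp, Function.surjInv_eq hp] at this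
  · obtain ⟨i, rfl⟩ := hp' b
    exact ⟨p i, (h _ _).1 (Function.surjInv_eq hp _)⟩

theorem finite_norm_le (n : ℕ) : {g : FreeGroup (Fin 2) | g.norm ≤ n}.Finite :=
  Set.Finite.of_finite_image
    ((List.finite_length_le (Fin 2 × Bool) n).subset (by rintro _ ⟨g, hg, rfl⟩; exact hg))
    (FreeGroup.toWord_injective.injOn)

/-- An element of the free group of length at most `n + 1` is either of length at most `n` or is
obtained from such an element by left multiplication by a generator or its inverse. -/
theorem norm_le_succ_cases {g : FreeGroup (Fin 2)} {n : ℕ} (hg : g.norm ≤ n + 1) :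
    g.norm ≤ n ∨ ∃ (s : Fin 2) (h : FreeGroup (Fin 2)), h.norm ≤ n ∧
      (g = FreeGroup.of s * h ∨ h = FreeGroup.of s * g) := by
  rcases hL : g.toWord with _ | ⟨⟨s, b⟩, L⟩
  · left
    rw [FreeGroup.norm, hL]
    simp
  · right
    have hlen : L.length ≤ n := by
      rw [FreeGroup.norm, hL] at hg
      simpa using hg
    have hgL : g = FreeGroup.mk [(s, b)] * FreeGroup.mk L := by
      rw [FreeGroup.mul_mk, List.singleton_append, ← hL, FreeGroup.mk_toWord]
    refine ⟨s, FreeGroup.mk L, FreeGroup.norm_mk_le.trans hlen, ?_⟩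
    cases b with
    | true => exact Or.inl hgL
    | false =>
      right
      rw [hgL, ← mul_assoc]
      have : FreeGroup.mk [(s, false)] = (FreeGroup.of s)⁻¹ := by
        rw [FreeGroup.of, FreeGroup.inv_mk]
        rfl
      rw [this, mul_inv_cancel, one_mul]

namespace PointedGraph

/-- The action of the free group on the vertices of a marked graph: the group element represented
by a word moves a vertex along the path with this word as the sequence of its labels, the letters
being read from right to left. -/
def walk (Γ : PointedGraph) : FreeGroup (Fin 2) →* Equiv.Perm Γ.V := FreeGroup.lift Γ.step

/-- The end of the path that starts at the selected vertex and has the given labels. -/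
def vertexAt (Γ : PointedGraph) (g : FreeGroup (Fin 2)) : Γ.V := Γ.walk g Γ.base

/-- The stabilizer of the selected vertex in the free group. -/
def stab (Γ : PointedGraph) : Subgroup (FreeGroup (Fin 2)) :=
  (MulAction.stabilizer (Equiv.Perm Γ.V) Γ.base).comap Γ.walk

theorem mem_stab {Γ : PointedGraph} {g : FreeGroup (Fin 2)} :
    g ∈ Γ.stab ↔ Γ.vertexAt g = Γ.base := Iff.rfl

theorem vertexAt_one (Γ : PointedGraph) : Γ.vertexAt 1 = Γ.base := by
  simp [vertexAt]

theorem vertexAt_of_mul (Γ : PointedGraph) (s : Fin 2) (g : FreeGroup (Fin 2)) :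
    Γ.vertexAt (FreeGroup.of s * g) = Γ.step s (Γ.vertexAt g) := by
  simp [vertexAt, walk]

theorem vertexAt_eq_iff {Γ : PointedGraph} {g h : FreeGroup (Fin 2)} :
    Γ.vertexAt g = Γ.vertexAt h ↔ g⁻¹ * h ∈ Γ.stab := by
  rw [mem_stab, vertexAt, vertexAt, vertexAt, map_mul, map_inv, Equiv.Perm.mul_apply,
    Equiv.Perm.inv_eq_iff_eq, eq_comm]

theorem arrow_vertexAt_iff {Γ : PointedGraph} {s : Fin 2} {g h : FreeGroup (Fin 2)} :
    Γ.Arrow s (Γ.vertexAt g) (Γ.vertexAt h) ↔ (FreeGroup.of s * g)⁻¹ * h ∈ Γ.stab := by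
  rw [← vertexAt_eq_iff, vertexAt_of_mul, Arrow]

theorem mem_ball_iff {Γ : PointedGraph} {n : ℕ} {v : Γ.V} :
    v ∈ Γ.ball n ↔ ∃ g : FreeGroup (Fin 2), g.norm ≤ n ∧ Γ.vertexAt g = v := by
  induction n generalizing v with
  | zero =>
    constructor
    · intro hv
      exact ⟨1, by simp, (vertexAt_one Γ).trans (Eq.symm hv)⟩
    · rintro ⟨g, hg, rfl⟩
      rw [FreeGroup.norm_eq_zero.1 (Nat.le_zero.1 hg), vertexAt_one]
      rfl
  | succ n ih =>
    constructor
    · rintro (hv | ⟨u, hu, s, h⟩)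
      · obtain ⟨g, hg, h⟩ := ih.1 hv
        exact ⟨g, hg.trans n.le_succ, h⟩
      · obtain ⟨g, hg, rfl⟩ := ih.1 hu
        rcases h with h | h
        · refine ⟨FreeGroup.of s * g, ?_, by rw [vertexAt_of_mul]; exact h⟩
          have := FreeGroup.norm_mul_le (FreeGroup.of s) g
          rw [FreeGroup.norm_of] at this
          omega
        · refine ⟨(FreeGroup.of s)⁻¹ * g, ?_, ?_⟩
          · have := FreeGroup.norm_mul_le (FreeGroup.of s)⁻¹ g
            rw [FreeGroup.norm_inv_eq, FreeGroup.norm_of] at this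
            omega
          · apply (Γ.step s).injective
            rw [← vertexAt_of_mul, mul_inv_cancel_left]
            exact Eq.symm h
    · rintro ⟨g, hg, rfl⟩
      rcases norm_le_succ_cases hg with hg' | ⟨s, h, hh, rfl | rfl⟩
      · exact Or.inl (ih.2 ⟨g, hg', rfl⟩)
      · exact Or.inr ⟨_, ih.2 ⟨h, hh, rfl⟩, s, Or.inl (vertexAt_of_mul Γ s h).symm⟩
      · exact Or.inr ⟨_, ih.2 ⟨_, hh, rfl⟩, s, Or.inr (vertexAt_of_mul Γ s g).symm⟩

theorem BallIso.mem_stab_iff {Γ Δ : PointedGraph} {n : ℕ} (h : BallIso n Γ Δ)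
    {g : FreeGroup (Fin 2)} (hg : g.norm ≤ n) : g ∈ Γ.stab ↔ g ∈ Δ.stab := by
  obtain ⟨e, hb, he⟩ := h
  have key : ∀ k ≤ n, ∀ g : FreeGroup (Fin 2), g.norm ≤ k → ∀ hg : Γ.vertexAt g ∈ Γ.ball n,
      (e ⟨Γ.vertexAt g, hg⟩ : Δ.V) = Δ.vertexAt g := by
    intro k
    induction k with
    | zero =>
      intro _ g hg hmem
      obtain rfl := FreeGroup.norm_eq_zero.1 (Nat.le_zero.1 hg)
      simp only [vertexAt_one, hb]
    | succ k ih =>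
      intro hk g hg hmem
      rcases norm_le_succ_cases hg with hg' | ⟨s, h, hh, rfl | rfl⟩
      · exact ih (by omega) g hg' hmem
      · have hm : Γ.vertexAt h ∈ Γ.ball n := mem_ball_iff.2 ⟨h, by omega, rfl⟩
        have := (he s ⟨_, hm⟩ ⟨_, hmem⟩).1 (vertexAt_of_mul Γ s h).symm
        rw [ih (by omega) h hh hm, Arrow] at this
        rw [← this, vertexAt_of_mul]
      · have hm : Γ.vertexAt (FreeGroup.of s * g) ∈ Γ.ball n :=
          mem_ball_iff.2 ⟨_, by omega, rfl⟩
        have := (he s ⟨_, hmem⟩ ⟨_, hm⟩).1 (vertexAt_of_mul Γ s g).symm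
        rw [ih (by omega) _ hh hm, vertexAt_of_mul, Arrow] at this
        exact (Δ.step s).injective this
  have hm : Γ.vertexAt g ∈ Γ.ball n := mem_ball_iff.2 ⟨g, hg, rfl⟩
  have h1 := key n le_rfl g hg hm
  rw [mem_stab, mem_stab, ← h1, ← Subtype.mk.injEq (Γ.vertexAt g) hm Γ.base (base_mem_ball Γ n),
    ← e.apply_eq_iff_eq, hb, Subtype.ext_iff]

/-- The ball of radius `n` is determined by the elements of length at most `2 * n + 1` of the
stabilizer of its center: it takes words of length at most `n` to reach two vertices of the ball,
and one more letter to test whether an arrow joins them. -/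
theorem ballIso_of_stab {Γ Δ : PointedGraph} {n : ℕ}
    (h : ∀ g : FreeGroup (Fin 2), g.norm ≤ 2 * n + 1 → (g ∈ Γ.stab ↔ g ∈ Δ.stab)) :
    BallIso n Γ Δ := by
  have hsurj : ∀ Θ : PointedGraph, Function.Surjective
      (fun g : {g : FreeGroup (Fin 2) // g.norm ≤ n} =>
        (⟨Θ.vertexAt g, mem_ball_iff.2 ⟨g, g.2, rfl⟩⟩ : Θ.ball n)) := by
    rintro Θ ⟨v, hv⟩
    obtain ⟨g, hg, rfl⟩ := mem_ball_iff.1 hv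
    exact ⟨⟨g, hg⟩, rfl⟩
  obtain ⟨e, he⟩ := exists_equiv_of_surjective (hsurj Γ) (hsurj Δ) (by
    rintro ⟨g, hg⟩ ⟨g', hg'⟩
    rw [Subtype.mk.injEq, Subtype.mk.injEq, vertexAt_eq_iff, vertexAt_eq_iff]
    refine h _ ((FreeGroup.norm_mul_le _ _).trans ?_)
    rw [FreeGroup.norm_inv_eq]
    dsimp only
    omega)
  refine ⟨e, ?_, fun s u v => ?_⟩
  · have := he ⟨1, by simp⟩
    simpa only [vertexAt_one] using this
  · obtain ⟨⟨g, hg⟩, rfl⟩ := hsurj Γ u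
    obtain ⟨⟨g', hg'⟩, rfl⟩ := hsurj Γ v
    rw [he, he, arrow_vertexAt_iff, arrow_vertexAt_iff]
    refine h _ ((FreeGroup.norm_mul_le _ _).trans ?_)
    have := FreeGroup.norm_mul_le (FreeGroup.of s) g
    rw [FreeGroup.norm_of] at this
    rw [FreeGroup.norm_inv_eq]
    dsimp only
    omega

theorem vertexAt_surjective (Γ : PointedGraph) : Function.Surjective Γ.vertexAt := by
  have key : ∀ u v, Relation.EqvGen (fun u w => ∃ s, Γ.step s u = w) u v →
      ((∃ g, Γ.vertexAt g = u) ↔ ∃ g, Γ.vertexAt g = v) := by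
    intro u v h
    induction h with
    | rel u v h =>
      obtain ⟨s, rfl⟩ := h
      constructor
      · rintro ⟨g, rfl⟩
        exact ⟨_, vertexAt_of_mul Γ s g⟩
      · rintro ⟨g, hg⟩
        refine ⟨(FreeGroup.of s)⁻¹ * g, (Γ.step s).injective ?_⟩
        rw [← vertexAt_of_mul, mul_inv_cancel_left, hg]
    | refl => exact Iff.rfl
    | symm _ _ _ ih => exact ih.symm
    | trans _ _ _ _ _ ih ih' => exact ih.trans ih'
  exact fun v => (key _ v (Γ.connected v)).1 ⟨1, vertexAt_one Γ⟩

theorem iso_iff_stab_eq {Γ Δ : PointedGraph} : Iso Γ Δ ↔ Γ.stab = Δ.stab := by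
  constructor
  · rintro ⟨e, hb, he⟩
    have key : ∀ (g : FreeGroup (Fin 2)) (v : Γ.V), e (Γ.walk g v) = Δ.walk g (e v) := by
      intro g
      induction g using FreeGroup.induction_on with
      | C1 => simp
      | of s => exact fun v => by simpa [walk, Arrow, eq_comm] using he s v (Γ.step s v)
      | inv_of s ih =>
        intro v
        rw [map_inv, map_inv, Equiv.Perm.eq_inv_iff_eq, ← ih, ← Equiv.Perm.mul_apply,
          mul_inv_cancel, Equiv.Perm.one_apply]
      | mul g h ihg ihh => exact fun v => by simp [ihg, ihh]
    ext g
    rw [mem_stab, mem_stab, vertexAt, vertexAt, ← hb, ← key, e.apply_eq_iff_eq]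
  · intro h
    obtain ⟨e, he⟩ := exists_equiv_of_surjective Γ.vertexAt_surjective Δ.vertexAt_surjective
      (fun g g' => by rw [vertexAt_eq_iff, vertexAt_eq_iff, h])
    refine ⟨e, by rw [← vertexAt_one, he, vertexAt_one], fun s u v => ?_⟩
    obtain ⟨g, rfl⟩ := Γ.vertexAt_surjective u
    obtain ⟨g', rfl⟩ := Γ.vertexAt_surjective v
    rw [he, he, arrow_vertexAt_iff, arrow_vertexAt_iff, h]

theorem gdist_le_of_ballIso {Γ Δ : PointedGraph} {n : ℕ} (h : BallIso n Γ Δ) :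
    gdist Γ Δ ≤ (1 / 2) ^ n := by
  refine (ciInf_le ⟨0, ?_⟩ n).trans_eq (if_pos h)
  rintro _ ⟨m, rfl⟩
  dsimp only
  split_ifs <;> positivity

theorem exists_ballIso_of_gdist_lt {Γ Δ : PointedGraph} {n : ℕ} (h : gdist Γ Δ < (1 / 2) ^ n) :
    ∃ m, n ≤ m ∧ BallIso m Γ Δ := by
  obtain ⟨m, hm⟩ := exists_lt_of_ciInf_lt h
  split_ifs at hm with hb
  · exact ⟨m, ((pow_lt_pow_iff_right_of_lt_one₀ (by norm_num) (by norm_num)).1 hm).le, hb⟩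
  · exact absurd hm (not_lt.2 (pow_le_one₀ (by norm_num) (by norm_num)))

/-- The Schreier coset graph of a subgroup of the free group, pointed at the trivial coset. -/
def cosetGraph (H : Subgroup (FreeGroup (Fin 2))) : PointedGraph where
  V := FreeGroup (Fin 2) ⧸ H
  step s := MulAction.toPerm (FreeGroup.of s)
  base := ((1 : FreeGroup (Fin 2)) : FreeGroup (Fin 2) ⧸ H)
  connected v := by
    have key : ∀ (g : FreeGroup (Fin 2)) (v : FreeGroup (Fin 2) ⧸ H), Relation.EqvGen
        (fun u w : FreeGroup (Fin 2) ⧸ H =>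
          ∃ s : Fin 2, MulAction.toPerm (FreeGroup.of s) u = w)
        v (g • v) := by
      intro g
      induction g using FreeGroup.induction_on with
      | C1 => exact fun v => by rw [one_smul]; exact .refl v
      | of s => exact fun v => .rel _ _ ⟨s, rfl⟩
      | inv_of s ih =>
        intro v
        have := ih ((FreeGroup.of s)⁻¹ • v)
        rw [smul_inv_smul] at this
        exact .symm _ _ this
      | mul g h ihg ihh => exact fun v => by rw [mul_smul]; exact .trans _ _ _ (ihh v) (ihg _)
    obtain ⟨g, rfl⟩ := QuotientGroup.mk_surjective v
    have := key g ((1 : FreeGroup (Fin 2)) : FreeGroup (Fin 2) ⧸ H)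
    rwa [MulAction.Quotient.smul_coe, smul_eq_mul, mul_one] at this

theorem stab_cosetGraph (H : Subgroup (FreeGroup (Fin 2))) : (cosetGraph H).stab = H := by
  have hw : (cosetGraph H).walk = MulAction.toPermHom _ (FreeGroup (Fin 2) ⧸ H) :=
    FreeGroup.ext_hom _ _ fun s => by
      rw [walk, FreeGroup.lift_apply_of]
      rfl
  ext g
  rw [mem_stab, vertexAt, hw]
  change g • ((1 : FreeGroup (Fin 2)) : FreeGroup (Fin 2) ⧸ H)
    = ((1 : FreeGroup (Fin 2)) : FreeGroup (Fin 2) ⧸ H) ↔ _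
  rw [MulAction.Quotient.smul_coe, smul_eq_mul, mul_one, eq_comm, QuotientGroup.eq, inv_one,
    one_mul]

end PointedGraph

namespace GraphSpace

open PointedGraph

/-- The stabilizer of the selected vertex of an isomorphism class of pointed marked graphs. -/
def stab : GraphSpace → Subgroup (FreeGroup (Fin 2)) :=
  Quotient.lift PointedGraph.stab fun _ _ h => iso_iff_stab_eq.1 h

theorem stab_mk (Γ : PointedGraph) : (mk Γ).stab = Γ.stab := rfl

theorem mk_surjective : Function.Surjective mk := Quotient.mk_surjective

theorem stab_injective : Function.Injective stab := by
  intro x y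
  obtain ⟨Γ, rfl⟩ := mk_surjective x
  obtain ⟨Δ, rfl⟩ := mk_surjective y
  exact fun h => Quotient.sound (iso_iff_stab_eq.2 h)

open Classical in
/-- The indicator function of the stabilizer of the selected vertex. -/
noncomputable def code (x : GraphSpace) (g : FreeGroup (Fin 2)) : Bool := decide (g ∈ x.stab)

theorem code_injective : Function.Injective code := by
  intro x y h
  refine stab_injective (Subgroup.ext fun g => ?_)
  have := congrFun h g
  simpa [code] using this

theorem continuous_code : Continuous code := by
  refine continuous_pi fun g => continuous_discrete_rng.2 fun b => ?_
  intro Γ hΓ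
  refine ⟨(1 / 2) ^ g.norm, by positivity, fun Δ hΔ => ?_⟩
  obtain ⟨m, hm, hb⟩ := exists_ballIso_of_gdist_lt hΔ
  have : g ∈ Γ.stab ↔ g ∈ Δ.stab := hb.mem_stab_iff hm
  change code (mk Δ) g = b
  rw [← show code (mk Γ) g = b from hΓ]
  exact decide_eq_decide.2 this.symm

/-- The topology of the graph distance is the topology of pointwise convergence of stabilizers. -/
theorem isInducing_code : Topology.IsInducing code := by
  refine ⟨le_antisymm (continuous_iff_le_induced.1 continuous_code) fun U hU => ?_⟩
  refine (@isOpen_iff_mem_nhds _ (TopologicalSpace.induced code inferInstance) _).2 fun x hx => ?_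
  obtain ⟨Γ, rfl⟩ := mk_surjective x
  obtain ⟨ε, hε, hball⟩ := hU Γ hx
  obtain ⟨n, hn⟩ := exists_pow_lt_of_lt_one hε (show (1 / 2 : ℝ) < 1 by norm_num)
  refine (mem_nhds_induced _ _ _).2 ⟨_, set_pi_mem_nhds (finite_norm_le (2 * n + 1)) fun g _ =>
    (isOpen_discrete {code (mk Γ) g}).mem_nhds rfl, ?_⟩
  intro y hy
  obtain ⟨Δ, rfl⟩ := mk_surjective y
  refine hball Δ ((gdist_le_of_ballIso (ballIso_of_stab fun g hg => ?_)).trans_lt hn)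
  have : code (mk Δ) g = code (mk Γ) g := hy g hg
  exact decide_eq_decide.1 this.symm

theorem tendsto_nhds_iff {ι : Type*} {u : ι → GraphSpace} {l : Filter ι} {x : GraphSpace} :
    Tendsto u l (𝓝 x) ↔ ∀ g, ∀ᶠ i in l, (g ∈ (u i).stab ↔ g ∈ x.stab) := by
  rw [isInducing_code.tendsto_nhds_iff, tendsto_pi_nhds]
  refine forall_congr' fun g => ?_
  rw [nhds_discrete, tendsto_pure]
  simp [code]

theorem isOpen_mem_stab (g : FreeGroup (Fin 2)) : IsOpen {x : GraphSpace | g ∈ x.stab} := by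
  have := (isOpen_discrete {true}).preimage ((continuous_apply g).comp continuous_code)
  simpa [Set.preimage, code] using this

instance : T2Space GraphSpace := T2Space.of_injective_continuous code_injective continuous_code

/-- An ultrafilter on the space of graphs converges to the coset graph of the subgroup of all
elements that almost all stabilizers contain. -/
instance : CompactSpace GraphSpace where
  isCompact_univ := by
    refine isCompact_iff_ultrafilter_le_nhds.2 fun U _ => ?_
    let H : Subgroup (FreeGroup (Fin 2)) :=
      { carrier := {g | ∀ᶠ x in (U : Filter GraphSpace), g ∈ x.stab}
        one_mem' := Eventually.of_forall fun x => one_mem _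
        mul_mem' := fun h h' => (h.and h').mono fun x hx => mul_mem hx.1 hx.2
        inv_mem' := fun h => h.mono fun x hx => inv_mem hx }
    refine ⟨mk (cosetGraph H), trivial, ?_⟩
    refine tendsto_id'.1 (tendsto_nhds_iff.2 fun g => ?_)
    rw [stab_mk, stab_cosetGraph]
    by_cases hg : g ∈ H
    · exact Eventually.mono hg fun x hx => iff_of_true hx hg
    · exact (Ultrafilter.eventually_not.2 hg).mono fun x hx => iff_of_false hx hg

end GraphSpace

/-! ### Binary words: prefixes, cuts and finite fibres -/

/-- The integer with binary digits `w₀ … w_{n-1}`. -/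
def prefixNat (w : Cantor) : ℕ → ℕ
  | 0 => 0
  | n + 1 => 2 * prefixNat w n + (w n : ℕ)

theorem prefixNat_lt (w : Cantor) (n : ℕ) : prefixNat w n < 2 ^ n := by
  induction n with
  | zero => simp [prefixNat]
  | succ n ih =>
    have := (w n).isLt
    rw [prefixNat, pow_succ]
    omega

theorem two_pow_mul_ofDigits (w : Cantor) (n : ℕ) :
    (2 : ℝ) ^ n * Real.ofDigits w = prefixNat w n + Real.ofDigits (fun i => w (i + n)) := by
  induction n with
  | zero => simp [prefixNat]
  | succ n ih =>
    have h := ofDigits_cons (fun i => w (i + n))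
    have h2 : (fun i => w (i + 1 + n)) = fun i => w (i + (n + 1)) :=
      funext fun i => congrArg w (by ring)
    simp only [zero_add, h2] at h
    rw [pow_succ', mul_assoc, ih, h, prefixNat]
    push_cast
    ring

theorem prefixNat_div_le (w : Cantor) (n : ℕ) : (prefixNat w n : ℝ) / 2 ^ n ≤ value w := by
  rw [div_le_iff₀' (by positivity)]
  have := Real.ofDigits_nonneg (fun i => w (i + n))
  exact (le_add_of_nonneg_right this).trans_eq (two_pow_mul_ofDigits w n).symm

theorem value_le_prefixNat_succ_div (w : Cantor) (n : ℕ) :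
    (value w : ℝ) ≤ (prefixNat w n + 1 : ℝ) / 2 ^ n := by
  rw [le_div_iff₀' (by positivity)]
  have := Real.ofDigits_le_one (fun i => w (i + n))
  exact (two_pow_mul_ofDigits w n).trans_le (by linarith)

theorem digit_eq_prefixNat_mod (w : Cantor) (n : ℕ) : w n = Fin.ofNat 2 (prefixNat w (n + 1)) := by
  apply Fin.ext
  have := (w n).isLt
  rw [Fin.val_ofNat, prefixNat]
  omega

theorem continuous_prefixNat (n : ℕ) : Continuous fun w => prefixNat w n := by
  induction n with
  | zero => exact continuous_const
  | succ n ih =>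
    exact (continuous_const.mul ih).add
      ((continuous_of_discreteTopology (f := fun a : Fin 2 => (a : ℕ))).comp (continuous_apply n))

theorem endsInOnes_shift_iff {w : Cantor} (n : ℕ) :
    EndsInOnes (fun i => w (i + n)) ↔ EndsInOnes w := by
  constructor
  · rintro ⟨N, hN⟩
    refine ⟨N + n, fun m hm => ?_⟩
    have := hN (m - n) (by omega)
    dsimp only at this
    rwa [Nat.sub_add_cancel (by omega)] at this
  · rintro ⟨N, hN⟩
    exact ⟨N, fun m hm => hN _ (by omega)⟩

/-- The words to the right of the cut at the point `q`: the two expansions of a dyadic `q` are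
separated, only the one which does not end in `111…` being to the right of the cut. -/
def rightOfCut (q : I01) : Set Cantor := {v | q < value v ∨ value v = q ∧ ¬ EndsInOnes v}

theorem smul_endsInOnes_iff (f : F) (v : Cantor) : EndsInOnes (f • v) ↔ EndsInOnes v :=
  (cantorMap_spec f v).2

theorem value_smul (f : F) (v : Cantor) : value (f • v) = f • value v := (cantorMap_spec f v).1

theorem smul_mem_rightOfCut_iff {f : F} {q : I01} {v : Cantor} :
    f • v ∈ rightOfCut (f • q) ↔ v ∈ rightOfCut q := by
  have h1 : f • q < f • value v ↔ q < value v := f.1.lt_iff_lt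
  have h2 : f • value v = f • q ↔ value v = q := f.1.apply_eq_iff_eq
  simp only [rightOfCut, Set.mem_ofPred_eq, value_smul, smul_endsInOnes_iff, h1, h2]

theorem mem_rightOfCut_iff {q : I01} {k n : ℕ} (hq : (q : ℝ) = k / 2 ^ n) {v : Cantor} :
    v ∈ rightOfCut q ↔ k ≤ prefixNat v n := by
  have hpos : (0 : ℝ) < 2 ^ n := by positivity
  have hv : (2 : ℝ) ^ n * value v = prefixNat v n + Real.ofDigits (fun i => v (i + n)) :=
    two_pow_mul_ofDigits v n
  constructor
  · intro h
    by_contra hlt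
    have hk : (prefixNat v n : ℝ) + 1 ≤ k := by exact_mod_cast not_le.1 hlt
    have hle : (value v : ℝ) ≤ q := by
      rw [hq]
      exact (value_le_prefixNat_succ_div v n).trans (by gcongr)
    rcases h with h | ⟨h, h'⟩
    · exact absurd hle (not_le.2 h)
    · refine h' ((endsInOnes_shift_iff n).1 ⟨0, fun m _ =>
        eq_one_of_ofDigits_eq_one (w := fun i => v (i + n)) ?_ m⟩)
      have := Real.ofDigits_le_one (fun i => v (i + n))
      rw [h, hq, mul_div_cancel₀ _ hpos.ne'] at hv
      linarith
  · intro h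
    have hk : (k : ℝ) ≤ prefixNat v n := by exact_mod_cast h
    have hle : (q : ℝ) ≤ value v := by
      rw [hq]
      exact le_trans (by gcongr) (prefixNat_div_le v n)
    rcases hle.lt_or_eq with h' | h'
    · exact Or.inl h'
    · refine Or.inr ⟨Subtype.ext h'.symm, fun hE => ?_⟩
      have h0 : (0 : ℝ) < Real.ofDigits (fun i => v (i + n)) :=
        ((endsInOnes_shift_iff n).2 hE).value_pos
      rw [← h', hq, mul_div_cancel₀ _ hpos.ne'] at hv
      linarith

theorem exists_nat_of_isDyadic {q : I01} (hq : IsDyadic (q : ℝ)) :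
    ∃ k n : ℕ, (q : ℝ) = k / 2 ^ n := by
  obtain ⟨k, n, h⟩ := hq
  have hk : 0 ≤ k := by
    have := q.2.1
    rw [h, le_div_iff₀ (by positivity), zero_mul] at this
    exact_mod_cast this
  lift k to ℕ using hk
  exact ⟨k, n, h⟩

theorem isClopen_rightOfCut {q : I01} (hq : IsDyadic (q : ℝ)) : IsClopen (rightOfCut q) := by
  obtain ⟨k, n, h⟩ := exists_nat_of_isDyadic hq
  have : rightOfCut q = (fun w => prefixNat w n) ⁻¹' Set.Ici k :=
    Set.ext fun v => mem_rightOfCut_iff h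
  rw [this]
  exact (isClopen_discrete _).preimage (continuous_prefixNat n)

/-- Distinct words are separated by a dyadic cut. -/
theorem exists_cut_of_ne {v w : Cantor} (h : v ≠ w) :
    ∃ q : I01, IsDyadic (q : ℝ) ∧ 0 < (q : ℝ) ∧ (q : ℝ) < 1 ∧
      ¬ (v ∈ rightOfCut q ↔ w ∈ rightOfCut q) := by
  obtain ⟨n, hn⟩ : ∃ n, prefixNat v n ≠ prefixNat w n := by
    by_contra! hall
    exact h (funext fun m => by rw [digit_eq_prefixNat_mod v, digit_eq_prefixNat_mod w, hall])
  have hpos : (0 : ℝ) < 2 ^ n := by positivity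
  have hlt : max (prefixNat v n) (prefixNat w n) < 2 ^ n :=
    max_lt (prefixNat_lt v n) (prefixNat_lt w n)
  generalize hk : max (prefixNat v n) (prefixNat w n) = k at hlt
  have h0 : (0 : ℝ) < k := by
    have : 0 < k := by omega
    exact_mod_cast this
  have h1 : (k : ℝ) < 2 ^ n := by exact_mod_cast hlt
  have hq0 : (0 : ℝ) < k / 2 ^ n := by positivity
  have hq1 : (k : ℝ) / 2 ^ n < 1 := by rwa [div_lt_one hpos]
  refine ⟨⟨k / 2 ^ n, hq0.le, hq1.le⟩, ⟨k, n, by simp⟩, hq0, hq1, ?_⟩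
  rw [mem_rightOfCut_iff (k := k) (n := n) rfl, mem_rightOfCut_iff (k := k) (n := n) rfl]
  omega

theorem finite_value_preimage {T : Set I01} (hT : T.Finite) : {v | value v ∈ T}.Finite := by
  refine hT.preimage' fun t _ => Set.Finite.of_finite_image (f := EndsInOnes) (Set.toFinite _) ?_
  intro v hv w hw h
  exact cantor_ext (Eq.trans hv (Eq.symm hw)) (iff_of_eq h)

/-! ### Local behaviour of the elements of `F` on the Cantor set -/

theorem continuous_smul_cantor (f : F) : Continuous fun v : Cantor => f • v := by
  have hcut : ∀ k n : ℕ, IsClopen {v : Cantor | k ≤ prefixNat (f • v) n} := by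
    intro k n
    rcases le_or_gt k (2 ^ n) with hk | hk
    · have hq : (k : ℝ) / 2 ^ n ∈ Set.Icc (0 : ℝ) 1 :=
        ⟨by positivity, div_le_one_of_le₀ (by exact_mod_cast hk) (by positivity)⟩
      have hset : {v : Cantor | k ≤ prefixNat (f • v) n}
          = rightOfCut (f⁻¹ • (⟨_, hq⟩ : I01)) := by
        ext v
        rw [← smul_mem_rightOfCut_iff (f := f), smul_inv_smul,
          mem_rightOfCut_iff (k := k) (n := n) rfl, Set.mem_ofPred_eq]
      rw [hset]
      exact isClopen_rightOfCut (IsThompson.isDyadic (f⁻¹).2 ⟨k, n, by simp⟩)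
    · convert isClopen_empty
      ext v
      simpa using (prefixNat_lt (f • v) n).trans hk
  have hpre : ∀ n, Continuous fun v : Cantor => prefixNat (f • v) n := by
    refine fun n => continuous_discrete_rng.2 fun k => ?_
    convert ((hcut k n).diff (hcut (k + 1) n)).isOpen using 1
    ext v
    simp only [Set.mem_preimage, Set.mem_singleton_iff, Set.mem_sdiff, Set.mem_ofPred_eq]
    omega
  refine continuous_pi fun n => ?_
  have : (fun v : Cantor => (f • v) n) = Fin.ofNat 2 ∘ fun v => prefixNat (f • v) (n + 1) :=
    funext fun v => digit_eq_prefixNat_mod (f • v) n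
  rw [this]
  exact continuous_of_discreteTopology.comp (hpre (n + 1))

instance : ContinuousConstSMul F Cantor := ⟨continuous_smul_cantor⟩

theorem exists_common_denominator {s : Finset ℝ} (hs : ∀ c ∈ s, IsDyadic c) :
    ∃ n : ℕ, ∀ c ∈ s, ∃ k : ℤ, c = k / 2 ^ n := by
  classical
  induction s using Finset.induction_on with
  | empty => exact ⟨0, by simp⟩
  | insert c s _ ih =>
    obtain ⟨n, hn⟩ := ih fun c hc => hs c (Finset.mem_insert_of_mem hc)
    obtain ⟨k, m, hc⟩ := hs c (Finset.mem_insert_self _ _)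
    refine ⟨n + m, fun c' hc' => ?_⟩
    rcases Finset.mem_insert.1 hc' with rfl | hc'
    · refine ⟨k * 2 ^ n, ?_⟩
      rw [hc, pow_add]
      push_cast
      field_simp
    · obtain ⟨l, hl⟩ := hn c' hc'
      refine ⟨l * 2 ^ m, ?_⟩
      rw [hl, pow_add]
      push_cast
      field_simp

/-- Every element of `F` is affine on the intervals of words with a common prefix of a sufficiently
large length `n`, because no breakpoint is in the interior of such an interval as soon as all
denominators of the breakpoints divide `2 ^ n`. -/
theorem exists_affine_on_cylinders (f : F) :
    ∃ n : ℕ, ∀ w : Cantor, ∃ (m : ℤ) (d : ℝ), ∀ v, prefixNat v n = prefixNat w n →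
      ((f • value v : I01) : ℝ) = 2 ^ m * (value v : ℝ) + d := by
  obtain ⟨s, hs, hf⟩ := f.2
  obtain ⟨n, hn⟩ := exists_common_denominator hs
  refine ⟨n, fun w => ?_⟩
  have hpos : (0 : ℝ) < 2 ^ n := by positivity
  have hlt : (prefixNat w n : ℝ) + 1 ≤ 2 ^ n := by exact_mod_cast prefixNat_lt w n
  have ha : (prefixNat w n : ℝ) / 2 ^ n ∈ Set.Icc (0 : ℝ) 1 :=
    ⟨by positivity, by rw [div_le_one hpos]; linarith⟩
  have hb : (prefixNat w n + 1 : ℝ) / 2 ^ n ∈ Set.Icc (0 : ℝ) 1 :=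
    ⟨by positivity, by rwa [div_le_one hpos]⟩
  obtain ⟨m, d, h⟩ := hf ⟨_, ha⟩ ⟨_, hb⟩
    (Subtype.mk_le_mk.2 (by gcongr; linarith)) (by
      rintro c hc ⟨h1, h2⟩
      obtain ⟨k, rfl⟩ := hn c hc
      rw [div_lt_div_iff_of_pos_right hpos] at h1 h2
      have h1' : (prefixNat w n : ℤ) < k := by exact_mod_cast h1
      have h2' : k < (prefixNat w n : ℤ) + 1 := by exact_mod_cast h2
      omega)
  refine ⟨m, d, fun v hv => h (value v) ?_ ?_⟩
  · have := prefixNat_div_le v n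
    rwa [hv] at this
  · have := value_le_prefixNat_succ_div v n
    rwa [hv] at this

theorem smul_cantor_eq_self_iff {f : F} {v : Cantor} : f • v = v ↔ f • value v = value v := by
  constructor
  · intro h
    rw [← value_smul, h]
  · intro h
    exact cantor_ext ((value_smul f v).trans h) (smul_endsInOnes_iff f v)

theorem eventually_notMem_of_finite {X : Type*} [TopologicalSpace X] [T1Space X]
    {A : Set X} (hA : A.Finite) (x : X) : ∀ᶠ y in 𝓝[≠] x, y ∉ A := by
  have hmem : (A \ {x})ᶜ ∈ 𝓝 x := (hA.sdiff).isClosed.isOpen_compl.mem_nhds (by simp)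
  rw [eventually_nhdsWithin_iff]
  filter_upwards [hmem] with y hy hyx hyA
  exact hy ⟨hyA, hyx⟩

/-- Near any given word, an element of `F` either is the identity or has at most this word as a
fixed point. -/
theorem eventually_fixed_or_eventually_moved (f : F) (w : Cantor) :
    (∀ᶠ v in 𝓝 w, f • v = v) ∨ ∀ᶠ v in 𝓝[≠] w, f • v ≠ v := by
  obtain ⟨n, hn⟩ := exists_affine_on_cylinders f
  obtain ⟨m, d, h⟩ := hn w
  have hcyl : ∀ᶠ v in 𝓝 w, prefixNat v n = prefixNat w n :=
    (continuous_prefixNat n).continuousAt.eventually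
      ((isOpen_discrete {prefixNat w n}).mem_nhds rfl)
  by_cases hm : (2 : ℝ) ^ m = 1
  · by_cases hd : d = 0
    · left
      filter_upwards [hcyl] with v hv
      refine smul_cantor_eq_self_iff.2 (Subtype.ext ?_)
      rw [h v hv, hm, hd]
      ring
    · right
      filter_upwards [hcyl.filter_mono nhdsWithin_le_nhds] with v hv hfix
      have := h v hv
      rw [smul_cantor_eq_self_iff.1 hfix, hm] at this
      exact hd (by linarith)
  · right
    have hne : (1 : ℝ) - 2 ^ m ≠ 0 := fun h0 => hm (by linarith)
    have hT : {t : I01 | (t : ℝ) = d / (1 - 2 ^ m)}.Finite :=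
      Set.Subsingleton.finite fun s hs t ht => Subtype.ext (Eq.trans hs (Eq.symm ht))
    filter_upwards [hcyl.filter_mono nhdsWithin_le_nhds,
      eventually_notMem_of_finite (finite_value_preimage hT) w] with v hv hvT hfix
    have := h v hv
    rw [smul_cantor_eq_self_iff.1 hfix] at this
    refine hvT ?_
    rw [eq_div_iff hne]
    linarith

/-! ### Dyadic rationals inside the Cantor set -/

theorem value_dyadicLabel (q : Dyadics) : value (dyadicLabel q) = q :=
  Subtype.ext (ofDigits_upperExpansion ⟨q.1.2.1, ((mem_orbit_half_iff _).1 q.2).2.2⟩)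

theorem not_endsInOnes_dyadicLabel (q : Dyadics) : ¬ EndsInOnes (dyadicLabel q) :=
  upperExpansion_not_endsInOnes ⟨q.1.2.1, ((mem_orbit_half_iff _).1 q.2).2.2⟩

theorem dyadicLabel_injective : Function.Injective dyadicLabel := fun p q h =>
  Subtype.ext (by rw [← value_dyadicLabel p, ← value_dyadicLabel q, h])

theorem dyadicLabel_smul (f : F) (q : Dyadics) : dyadicLabel (f • q) = f • dyadicLabel q := by
  refine cantor_ext ?_ ?_
  · rw [value_smul, value_dyadicLabel, value_dyadicLabel]
    rfl
  · rw [smul_endsInOnes_iff]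
    exact iff_of_false (not_endsInOnes_dyadicLabel _) (not_endsInOnes_dyadicLabel _)

/-- A nonzero word that is eventually zero is the label of a dyadic rational. -/
theorem exists_dyadicLabel_eq {u : Cantor} {N i : ℕ} (hN : ∀ n, N ≤ n → u n = 0) (hi : u i = 1) :
    ∃ q, dyadicLabel q = u := by
  have hE : ¬ EndsInOnes u := by
    rintro ⟨M, hM⟩
    have := (hN (max N M) (le_max_left _ _)).symm.trans (hM _ (le_max_right _ _))
    exact absurd this (by decide)
  have hzero : Real.ofDigits (fun _ => 0 : Cantor) = 0 := by
    simp [Real.ofDigits, Real.ofDigitsTerm]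
  have hval : (2 : ℝ) ^ N * Real.ofDigits u = prefixNat u N := by
    rw [two_pow_mul_ofDigits, show (fun i => u (i + N)) = fun _ => 0 from
      funext fun i => hN _ (Nat.le_add_left _ _), hzero, add_zero]
  have hne : (value u : ℝ) ≠ 0 := by
    intro h0
    have : u = fun _ => 0 := by
      refine cantor_ext (Subtype.ext (h0.trans hzero.symm)) (iff_of_false hE ?_)
      rintro ⟨M, hM⟩
      exact zero_ne_one (hM M le_rfl)
    rw [this] at hi
    exact zero_ne_one hi
  have hmem : value u ∈ MulAction.orbit F half := by
    refine (mem_orbit_half_iff _).2 ⟨⟨prefixNat u N, N, ?_⟩, ?_, value_lt_top hE⟩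
    · rw [eq_div_iff (by positivity), mul_comm]
      exact_mod_cast hval
    · exact lt_of_le_of_ne (value u).2.1 hne.symm
  exact ⟨⟨_, hmem⟩, upperExpansion_ofDigits hE⟩

/-- Every word is an accumulation point of the labels of dyadic rationals: change its `n`-th digit
and follow it by `1000…`. -/
instance neBot_comap_dyadicLabel (w : Cantor) : (comap dyadicLabel (𝓝[≠] w)).NeBot := by
  let u : ℕ → Cantor := fun n i =>
    if i < n then w i else if i = n then Fin.rev (w n) else if i = n + 1 then 1 else 0
  have hu : Tendsto u atTop (𝓝[≠] w) := by
    refine tendsto_nhdsWithin_iff.2 ⟨tendsto_pi_nhds.2 fun i => ?_, Eventually.of_forall ?_⟩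
    · refine tendsto_const_nhds.congr' ?_
      filter_upwards [eventually_gt_atTop i] with n hn
      simp [u, hn]
    · intro n hn
      have h1 : u n n = w n := congrFun hn n
      have h2 := rev_val (w n)
      simp only [u, lt_irrefl, if_false, if_true] at h1
      rw [h1] at h2
      omega
  have hlab : ∀ n, ∃ q, dyadicLabel q = u n := fun n =>
    exists_dyadicLabel_eq (N := n + 2) (i := n + 1)
      (fun m hm => by
        simp only [u]
        rw [if_neg (by omega), if_neg (by omega), if_neg (by omega)])
      (by simp [u])
  choose q hq using hlab
  have : Tendsto (dyadicLabel ∘ q) atTop (𝓝[≠] w) := by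
    rwa [show dyadicLabel ∘ q = u from funext hq]
  exact (tendsto_comap_iff.2 this).neBot

instance neBot_punctured_cantor (w : Cantor) : (𝓝[≠] w).NeBot :=
  ((neBot_comap_dyadicLabel w).map dyadicLabel).mono map_comap_le

theorem not_eventually_value_mem {T : Set I01} (hT : T.Finite) (w : Cantor) :
    ¬ ∀ᶠ v in 𝓝 w, value v ∈ T := by
  intro h
  obtain ⟨v, h1, h2⟩ := ((h.filter_mono nhdsWithin_le_nhds).and
    (eventually_notMem_of_finite (finite_value_preimage hT) w)).exists
  exact h2 h1

/-! ### Stabilizers, germ stabilizers and isolating elements -/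

/-- The element of `F` represented by a word in the generators `x₀`, `x₁`. -/
noncomputable def evalHom : FreeGroup (Fin 2) →* F := FreeGroup.lift gen

theorem evalHom_of (s : Fin 2) : evalHom (FreeGroup.of s) = gen s := FreeGroup.lift_apply_of

/-- The words in `x₀`, `x₁` act transitively on the dyadic rationals of `(0,1)`. This is all that the
argument uses about generation of `F`. -/
theorem exists_evalHom_smul_eq_half {q : I01} (hq : IsDyadic (q : ℝ)) (h0 : 0 < (q : ℝ))
    (h1 : (q : ℝ) < 1) : ∃ k, evalHom k • q = half := by
  obtain ⟨k, n, h⟩ := hq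
  obtain ⟨g, hg, hgq⟩ := reach_half n q h0 h1 ⟨k * 4, by
    rw [h]; push_cast; rw [pow_add]; field_simp; norm_num⟩
  rw [← FreeGroup.range_lift_eq_closure] at hg
  obtain ⟨k, rfl⟩ := hg
  exact ⟨k, hgq⟩

theorem mem_stab_schreierGraph_iff {q : Dyadics} {g : FreeGroup (Fin 2)} :
    g ∈ (schreierGraph q).stab ↔ evalHom g • dyadicLabel q = dyadicLabel q := by
  have hw : (schreierGraph q).walk = (MulAction.toPermHom F Dyadics).comp evalHom :=
    FreeGroup.ext_hom _ _ fun s => by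
      rw [PointedGraph.walk, FreeGroup.lift_apply_of]
      change _ = MulAction.toPermHom F Dyadics (evalHom (FreeGroup.of s))
      rw [evalHom_of]
      rfl
  rw [PointedGraph.mem_stab, PointedGraph.vertexAt, hw, ← dyadicLabel_smul,
    dyadicLabel_injective.eq_iff]
  rfl

/-- The subgroup of the words that act as the identity near `w`. -/
def germStab (w : Cantor) : Subgroup (FreeGroup (Fin 2)) where
  carrier := {g | ∀ᶠ v in 𝓝 w, evalHom g • v = v}
  one_mem' := Eventually.of_forall fun v => by rw [map_one, one_smul]
  mul_mem' := fun h h' => (h.and h').mono fun v hv => by rw [map_mul, mul_smul, hv.2, hv.1]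
  inv_mem' := fun h => h.mono fun v hv => by rw [map_inv, inv_smul_eq_iff, hv]

theorem mem_germStab_iff {w : Cantor} {g : FreeGroup (Fin 2)} :
    g ∈ germStab w ↔ ∀ᶠ v in 𝓝 w, evalHom g • v = v := Iff.rfl

theorem eventually_smul_eq_self_iff (g : FreeGroup (Fin 2)) (w : Cantor) :
    ∀ᶠ v in 𝓝[≠] w, (evalHom g • v = v ↔ g ∈ germStab w) := by
  rcases eventually_fixed_or_eventually_moved (evalHom g) w with h | h
  · filter_upwards [h.filter_mono nhdsWithin_le_nhds] with v hv
    exact iff_of_true hv h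
  · filter_upwards [h] with v hv
    refine iff_of_false hv fun hg => ?_
    obtain ⟨u, hu, hu'⟩ :=
      ((mem_germStab_iff.1 hg).filter_mono nhdsWithin_le_nhds |>.and h).exists
    exact hu' hu

theorem eventually_mem_germStab_iff (g : FreeGroup (Fin 2)) (w : Cantor) :
    ∀ᶠ v in 𝓝 w, (g ∈ germStab v ↔ g ∈ germStab w) := by
  by_cases hg : g ∈ germStab w
  · filter_upwards [eventually_eventually_nhds.2 (mem_germStab_iff.1 hg)] with v hv
    exact iff_of_true hv hg
  · have h := eventually_nhdsWithin_iff.1 (eventually_smul_eq_self_iff g w)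
    filter_upwards [h] with v hv
    refine iff_of_false (fun hgv => hg ?_) hg
    rcases eq_or_ne v w with rfl | hne
    · exact hgv
    · exact (hv hne).1 (mem_germStab_iff.1 hgv).self_of_nhds

theorem mem_germStab_smul_iff {k g : FreeGroup (Fin 2)} {w : Cantor} :
    g ∈ germStab (evalHom k • w) ↔ k⁻¹ * g * k ∈ germStab w := by
  have hmap : map (fun v : Cantor => evalHom k • v) (𝓝 w) = 𝓝 (evalHom k • w) :=
    (Homeomorph.smul (evalHom k)).map_nhds_eq w
  rw [mem_germStab_iff, mem_germStab_iff, ← hmap, eventually_map]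
  simp only [map_mul, map_inv, mul_smul, inv_smul_eq_iff]

/-- Distinct words have distinct germ stabilizers: after moving a dyadic cut that separates them
to `1/2`, the generator `x₁` is the identity near the word to the left of the cut, but not near
the word to its right. -/
theorem germStab_injective : Function.Injective germStab := by
  have key : ∀ v w : Cantor, v ∉ rightOfCut half → w ∈ rightOfCut half →
      germStab v ≠ germStab w := by
    intro v w hv hw h
    have hclopen : IsClopen (rightOfCut half) := isClopen_rightOfCut ⟨1, 1, by norm_num [half]⟩
    have hle : ∀ u : Cantor, u ∉ rightOfCut half → (value u : ℝ) ≤ 1 / 2 := fun u hu =>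
      not_lt.1 fun h' => hu (Or.inl h')
    have hge : ∀ u : Cantor, u ∈ rightOfCut half → 1 / 2 ≤ (value u : ℝ) := by
      rintro u (hu | hu)
      · exact le_of_lt hu
      · exact (congrArg Subtype.val hu.1).ge
    have hmem : FreeGroup.of 1 ∈ germStab v := by
      filter_upwards [hclopen.compl.isOpen.mem_nhds hv] with u hu
      rw [evalHom_of, smul_cantor_eq_self_iff]
      refine Subtype.ext ?_
      rw [gen_one_smul, x1Fun, if_pos (hle u hu)]
    rw [h] at hmem
    refine not_eventually_value_mem (T := {half, ⊤}) (by simp) w ?_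
    filter_upwards [hmem, hclopen.isOpen.mem_nhds hw] with u hu hu'
    rw [evalHom_of, smul_cantor_eq_self_iff] at hu
    have hu := congrArg Subtype.val hu
    have h1 := hge u hu'
    rw [gen_one_smul, x1Fun] at hu
    have hcases : (value u : ℝ) = 1 / 2 ∨ (value u : ℝ) = 1 := by
      split_ifs at hu
      · left; linarith
      · left; linarith
      · linarith
      · right; linarith
    exact hcases.imp Subtype.ext Subtype.ext
  intro v w h
  by_contra hne
  obtain ⟨q, hq, h0, h1, hcut⟩ := exists_cut_of_ne hne
  obtain ⟨k, hk⟩ := exists_evalHom_smul_eq_half hq h0 h1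
  rw [← smul_mem_rightOfCut_iff (f := evalHom k), hk,
    ← smul_mem_rightOfCut_iff (f := evalHom k) (v := w), hk] at hcut
  have h' : germStab (evalHom k • v) = germStab (evalHom k • w) :=
    Subgroup.ext fun g => by rw [mem_germStab_smul_iff, mem_germStab_smul_iff, h]
  by_cases hv : evalHom k • v ∈ rightOfCut half
  · exact key _ _ (fun hw => hcut (iff_of_true hv hw)) hv h'.symm
  · exact key _ _ hv (not_not.1 fun hw => hcut (iff_of_false hv hw)) h'

theorem x0Fun_eq_iff {s t : ℝ} : x0Fun s = t ↔ s = x0Inv t := by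
  constructor
  · rintro rfl
    unfold x0Inv x0Fun
    split_ifs <;> linarith
  · rintro rfl
    unfold x0Inv x0Fun
    split_ifs <;> linarith

/-- The word `x₀² x₁⁻¹ x₀⁻¹ x₁⁻¹` fixes only the points `0`, `1/2` and `1`. -/
theorem exists_fixed_iff_half : ∃ g : FreeGroup (Fin 2), ∀ t : I01,
    evalHom g • t = t ↔ t = ⊥ ∨ t = half ∨ t = ⊤ := by
  refine ⟨FreeGroup.of 0 * FreeGroup.of 0 * (FreeGroup.of 1)⁻¹ * (FreeGroup.of 0)⁻¹ *
    (FreeGroup.of 1)⁻¹, fun t => ?_⟩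
  have h1 : t = ⊥ ↔ (t : ℝ) = 0 := Subtype.ext_iff
  have h2 : t = half ↔ (t : ℝ) = 1 / 2 := Subtype.ext_iff
  have h3 : t = ⊤ ↔ (t : ℝ) = 1 := Subtype.ext_iff
  rw [h1, h2, h3, Subtype.ext_iff]
  simp only [map_mul, map_inv, evalHom_of, mul_smul, gen_zero_smul, inv_gen_zero_smul,
    inv_gen_one_smul]
  obtain ⟨t, ht0, ht1⟩ := t
  rw [x0Fun_eq_iff, x0Fun_eq_iff]
  dsimp only
  constructor
  · intro h
    by_contra! hne
    obtain ⟨hne0, hneh, hne1⟩ := hne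
    have ht0' := lt_of_le_of_ne ht0 hne0.symm
    have ht1' := lt_of_le_of_ne ht1 hne1
    rcases lt_or_gt_of_ne hneh with c | c
    · -- Here `x₁` fixes `t`, and `x₀⁻¹`, `x₁⁻¹` differ at the point `x₀⁻¹ t` of `(0, 3/4)`.
      have hu : 0 < x0Inv t ∧ x0Inv t < 3 / 4 := by
        unfold x0Inv
        constructor <;> split_ifs <;> linarith
      rw [show x1Inv t = t from if_pos c.le] at h
      generalize x0Inv t = u at h hu
      obtain ⟨hu0, hu1⟩ := hu
      unfold x1Inv x0Inv at h
      split_ifs at h <;> linarith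
    · -- The maps `x₀⁻¹`, `x₁⁻¹` agree right of `3/4`, so `t` would have to be fixed by `x₁⁻¹`.
      have hu : t < x1Inv t := by
        unfold x1Inv
        split_ifs <;> linarith
      have hx0 : ∀ u : ℝ, 1 / 2 < u → x0Inv u = (u + 1) / 2 := fun u hu => by
        rw [x0Inv, if_neg (by linarith), if_neg (by linarith)]
      have hx1 : ∀ u : ℝ, 3 / 4 < u → x1Inv u = (u + 1) / 2 := fun u hu => by
        rw [x1Inv, if_neg (by linarith), if_neg (by linarith), if_neg (by linarith)]
      rw [hx0 t c, hx0 _ (c.trans hu), hx0 _ (by linarith), hx1 _ (by linarith)] at h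
      linarith
  · rintro (rfl | rfl | rfl) <;> norm_num [x0Inv, x1Inv]

/-- For each dyadic rational `q` of `(0,1)` there is a word that fixes, apart from `0` and `1`, the
point `q` only. -/
theorem exists_isolating (q : Dyadics) : ∃ g : FreeGroup (Fin 2), ∀ t : I01,
    evalHom g • t = t ↔ t = ⊥ ∨ t = q ∨ t = ⊤ := by
  obtain ⟨hd, h0, h1⟩ := (mem_orbit_half_iff _).1 q.2
  obtain ⟨k, hk⟩ := exists_evalHom_smul_eq_half hd h0 h1
  obtain ⟨g, hg⟩ := exists_fixed_iff_half
  refine ⟨k⁻¹ * g * k, fun t => ?_⟩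
  have hbot : evalHom k • t = ⊥ ↔ t = ⊥ := map_eq_bot_iff (evalHom k).1
  have htop : evalHom k • t = ⊤ ↔ t = ⊤ := map_eq_top_iff (evalHom k).1
  rw [map_mul, map_mul, map_inv, mul_smul, mul_smul, inv_smul_eq_iff, hg, hbot, htop,
    show evalHom k • t = half ↔ t = q.1 by rw [← smul_left_cancel_iff (evalHom k) (x := t), hk]]

/-! ### The closure of the set of Schreier graphs -/

/-- The limit of the Schreier graphs of dyadic rationals whose labels converge to `w`. -/
def germGraph (w : Cantor) : GraphSpace := GraphSpace.mk (PointedGraph.cosetGraph (germStab w))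

theorem stab_germGraph (w : Cantor) : (germGraph w).stab = germStab w :=
  PointedGraph.stab_cosetGraph _

theorem tendsto_mk_schreierGraph (w : Cantor) :
    Tendsto (fun q => GraphSpace.mk (schreierGraph q)) (comap dyadicLabel (𝓝[≠] w))
      (𝓝 (germGraph w)) := by
  refine GraphSpace.tendsto_nhds_iff.2 fun g => ?_
  filter_upwards [(eventually_smul_eq_self_iff g w).comap dyadicLabel] with q hq
  rw [GraphSpace.stab_mk, mem_stab_schreierGraph_iff, stab_germGraph, hq]

/-- The graph `germGraph w` as a point of the closure of the set of Schreier graphs. -/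
def germPoint (w : Cantor) : SchreierClosure :=
  ⟨germGraph w, mem_closure_of_tendsto (tendsto_mk_schreierGraph w)
    (Eventually.of_forall fun q => ⟨q, rfl⟩)⟩

theorem tendsto_toClosure (w : Cantor) :
    Tendsto toClosure (comap dyadicLabel (𝓝[≠] w)) (𝓝 (germPoint w)) :=
  tendsto_subtype_rng.2 (tendsto_mk_schreierGraph w)

theorem continuous_germPoint : Continuous germPoint := by
  refine continuous_iff_continuousAt.2 fun w => tendsto_subtype_rng.2 ?_
  refine GraphSpace.tendsto_nhds_iff.2 fun g => ?_
  simpa only [germPoint, stab_germGraph] using eventually_mem_germStab_iff g w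

theorem germPoint_injective : Function.Injective germPoint := by
  intro v w h
  have h' := congrArg (fun x : SchreierClosure => x.1.stab) h
  simp only [germPoint, stab_germGraph] at h'
  exact germStab_injective h'

theorem isCompact_schreierClosure : IsCompact SchreierClosure := isClosed_closure.isCompact

instance : CompactSpace SchreierClosure := isCompact_iff_compactSpace.1 isCompact_schreierClosure

theorem denseRange_toClosure : DenseRange toClosure := by
  intro x
  rw [closure_subtype, ← Set.range_comp]
  exact x.2

theorem eq_pure_or_le_comap_dyadicLabel (U : Ultrafilter Dyadics) :
    (∃ q, U = pure q) ∨ ∃ w, (U : Filter Dyadics) ≤ comap dyadicLabel (𝓝[≠] w) := by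
  have hlim : Tendsto dyadicLabel U (𝓝 (U.map dyadicLabel).lim) :=
    Ultrafilter.le_nhds_lim (U.map dyadicLabel)
  generalize (U.map dyadicLabel).lim = w at hlim
  by_cases h : ∀ᶠ q in (U : Filter Dyadics), dyadicLabel q ≠ w
  · exact Or.inr ⟨w, tendsto_iff_comap.1 (tendsto_nhdsWithin_iff.2 ⟨hlim, h⟩)⟩
  · left
    have hfin : {q : Dyadics | dyadicLabel q = w}.Finite :=
      Set.Subsingleton.finite fun p hp q hq => dyadicLabel_injective (Eq.trans hp (Eq.symm hq))
    have hmem : {q : Dyadics | dyadicLabel q = w} ∈ U := by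
      filter_upwards [Ultrafilter.eventually_not.2 h] with q hq using not_not.1 hq
    obtain ⟨q, -, hq⟩ := Ultrafilter.eq_pure_of_finite_mem hfin hmem
    exact ⟨q, hq⟩

theorem eq_toClosure_or_eq_germPoint (x : SchreierClosure) :
    (∃ q, toClosure q = x) ∨ ∃ w, germPoint w = x := by
  have hx := denseRange_toClosure x
  rw [mem_closure_iff_clusterPt, ← map_top] at hx
  obtain ⟨U, -, hU⟩ := mapClusterPt_iff_ultrafilter.1 hx
  rcases eq_pure_or_le_comap_dyadicLabel U with ⟨q, rfl⟩ | ⟨w, hw⟩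
  · left
    have h1 : Tendsto toClosure (pure q) (𝓝 x) := hU
    exact ⟨q, tendsto_nhds_unique (tendsto_pure_nhds toClosure q) h1⟩
  · exact Or.inr ⟨w, tendsto_nhds_unique ((tendsto_toClosure w).mono_left hw) hU⟩

/-- A word that isolates `q` belongs to the stabilizer of no other point of the closure. -/
theorem exists_mem_stab_iff (q : Dyadics) : ∃ g : FreeGroup (Fin 2),
    (∀ p, g ∈ (toClosure p).1.stab ↔ p = q) ∧ ∀ w, g ∉ (germPoint w).1.stab := by
  obtain ⟨g, hg⟩ := exists_isolating q
  refine ⟨g, fun p => ?_, fun w hw => ?_⟩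
  · obtain ⟨-, h0, h1⟩ := (mem_orbit_half_iff _).1 p.2
    have h0' : p.1 ≠ ⊥ := fun h => h0.ne' (congrArg Subtype.val h)
    have h1' : p.1 ≠ ⊤ := fun h => h1.ne (congrArg Subtype.val h)
    rw [toClosure, GraphSpace.stab_mk, mem_stab_schreierGraph_iff, smul_cantor_eq_self_iff,
      value_dyadicLabel, hg, ← Subtype.ext_iff (a1 := p) (a2 := q)]
    simp only [h0', h1', false_or, or_false]
  · rw [germPoint, stab_germGraph, mem_germStab_iff] at hw
    refine not_eventually_value_mem (T := {⊥, q.1, ⊤}) (by simp) w (hw.mono fun v hv => ?_)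
    exact (hg _).1 (smul_cantor_eq_self_iff.1 hv)

theorem toClosure_injective : Function.Injective toClosure := by
  intro p q h
  obtain ⟨g, hg, -⟩ := exists_mem_stab_iff q
  exact (hg p).1 (h ▸ (hg q).2 rfl)

theorem toClosure_ne_germPoint (q : Dyadics) (w : Cantor) : toClosure q ≠ germPoint w := by
  intro h
  obtain ⟨g, hg, hg'⟩ := exists_mem_stab_iff q
  exact hg' w (h ▸ (hg q).2 rfl)

theorem isOpen_singleton_toClosure (q : Dyadics) : IsOpen {toClosure q} := by
  obtain ⟨g, hg, hg'⟩ := exists_mem_stab_iff q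
  convert (GraphSpace.isOpen_mem_stab g).preimage continuous_subtype_val using 1
  ext x
  rcases eq_toClosure_or_eq_germPoint x with ⟨p, rfl⟩ | ⟨w, rfl⟩
  · exact toClosure_injective.eq_iff.trans (hg p).symm
  · exact iff_of_false (toClosure_ne_germPoint q w).symm (hg' w)

theorem comap_toClosure_nhds_le (w : Cantor) :
    comap toClosure (𝓝 (germPoint w)) ≤ comap dyadicLabel (𝓝[≠] w) := by
  refine le_iff_ultrafilter.2 fun U hU => ?_
  have hlim : Tendsto toClosure U (𝓝 (germPoint w)) := tendsto_iff_comap.2 hU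
  rcases eq_pure_or_le_comap_dyadicLabel U with ⟨q, rfl⟩ | ⟨w', hw'⟩
  · exact absurd (tendsto_nhds_unique (tendsto_pure_nhds toClosure q) hlim)
      (toClosure_ne_germPoint q w)
  · rwa [← germPoint_injective
      (tendsto_nhds_unique ((tendsto_toClosure w').mono_left hw') hlim)]

/-- A map on the closure is continuous as soon as, along the dyadic rationals, it has the right
limits at the points `germPoint w`: all other points are isolated. -/
theorem continuous_of_tendsto_toClosure {Z : Type*} [TopologicalSpace Z] [RegularSpace Z]
    {H : SchreierClosure → Z}
    (h : ∀ w, Tendsto (H ∘ toClosure) (comap dyadicLabel (𝓝[≠] w)) (𝓝 (H (germPoint w)))) :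
    Continuous H := by
  refine continuous_iff_continuousAt.2 fun x => ?_
  rcases eq_toClosure_or_eq_germPoint x with ⟨q, rfl⟩ | ⟨w, rfl⟩
  · rw [ContinuousAt, (isOpen_singleton_iff_nhds_eq_pure _).1 (isOpen_singleton_toClosure q)]
    exact tendsto_pure_nhds _ _
  · refine (closed_nhds_basis (H (germPoint w))).tendsto_right_iff.2 ?_
    rintro V ⟨hV, hVc⟩
    obtain ⟨O, hO, hOV⟩ := mem_comap.1 (((h w).mono_left (comap_toClosure_nhds_le w)) hV)
    filter_upwards [eventually_mem_nhds_iff.2 hO] with y hy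
    rcases eq_toClosure_or_eq_germPoint y with ⟨q, rfl⟩ | ⟨w', rfl⟩
    · exact hOV (show toClosure q ∈ O from mem_of_mem_nhds hy)
    · refine hVc.mem_of_tendsto (h w') ?_
      filter_upwards [tendsto_toClosure w' hy] with q hq using hOV hq

/-! ### The Schreier dynamical system and its perfect kernel -/

/-- The closure is the disjoint union of the set of Schreier graphs of dyadic rationals and of the
Cantor set of their limits. -/
noncomputable def closureEquiv : Dyadics ⊕ Cantor ≃ SchreierClosure :=
  Equiv.ofBijective (Sum.elim toClosure germPoint) ⟨
    toClosure_injective.sumElim germPoint_injective toClosure_ne_germPoint, fun x => by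
      rcases eq_toClosure_or_eq_germPoint x with ⟨q, hq⟩ | ⟨w, hw⟩
      · exact ⟨Sum.inl q, hq⟩
      · exact ⟨Sum.inr w, hw⟩⟩

/-- The action of `F` on the closure given by its actions on dyadic rationals and on the Cantor
set. -/
noncomputable abbrev schreierAction : MulAction F SchreierClosure := closureEquiv.symm.mulAction F

theorem schreierAction_toClosure (f : F) (q : Dyadics) :
    schreierAction.smul f (toClosure q) = toClosure (f • q) := by
  change closureEquiv (f • closureEquiv.symm (closureEquiv (Sum.inl q))) = _
  rw [Equiv.symm_apply_apply]
  rfl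

theorem schreierAction_germPoint (f : F) (w : Cantor) :
    schreierAction.smul f (germPoint w) = germPoint (f • w) := by
  change closureEquiv (f • closureEquiv.symm (closureEquiv (Sum.inr w))) = _
  rw [Equiv.symm_apply_apply]
  rfl

theorem tendsto_smul_comap_dyadicLabel (f : F) (w : Cantor) :
    Tendsto (fun q : Dyadics => f • q) (comap dyadicLabel (𝓝[≠] w))
      (comap dyadicLabel (𝓝[≠] (f • w))) := by
  have h : Tendsto (fun v : Cantor => f • v) (𝓝[≠] w) (𝓝[≠] (f • w)) :=
    tendsto_nhdsWithin_iff.2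
      ⟨((continuous_smul_cantor f).tendsto w).mono_left nhdsWithin_le_nhds,
        eventually_mem_nhdsWithin.mono fun v hv => (MulAction.injective f).ne hv⟩
  refine tendsto_comap_iff.2 ?_
  rw [show dyadicLabel ∘ (fun q : Dyadics => f • q) = (fun v : Cantor => f • v) ∘ dyadicLabel from
    funext (dyadicLabel_smul f)]
  exact h.comp tendsto_comap

theorem isSchreierSystem_schreierAction : IsSchreierSystem schreierAction := by
  refine ⟨fun f => continuous_of_tendsto_toClosure fun w => ?_, schreierAction_toClosure⟩
  rw [schreierAction_germPoint, show schreierAction.smul f ∘ toClosure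
    = toClosure ∘ fun q : Dyadics => f • q from funext (schreierAction_toClosure f)]
  exact (tendsto_toClosure _).comp (tendsto_smul_comap_dyadicLabel f w)

theorem IsSchreierSystem.eq {A B : MulAction F SchreierClosure} (hA : IsSchreierSystem A)
    (hB : IsSchreierSystem B) : A = B := by
  refine MulAction.ext (funext fun f => ?_)
  refine denseRange_toClosure.equalizer (hA.1 f) (hB.1 f) (funext fun q => ?_)
  exact (hA.2 f q).trans (hB.2 f q).symm

theorem perfect_range_germPoint : Perfect (Set.range germPoint) := by
  refine ⟨(isCompact_range continuous_germPoint).isClosed, ?_⟩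
  rintro _ ⟨w, rfl⟩
  have h : Tendsto germPoint (𝓝[≠] w) (𝓝[≠] (germPoint w)) :=
    tendsto_nhdsWithin_iff.2 ⟨(continuous_germPoint.tendsto w).mono_left nhdsWithin_le_nhds,
      eventually_mem_nhdsWithin.mono fun v hv => germPoint_injective.ne hv⟩
  refine accPt_iff_frequently_nhdsNE.2 (h.frequently (Eventually.frequently ?_))
  exact Eventually.of_forall fun v => ⟨v, rfl⟩

theorem kernelD_eq_range_germPoint : kernelD = Set.range germPoint := by
  refine Set.Subset.antisymm (fun x hx => ?_)
    (perfect_range_germPoint.subset_perfectKernel (Set.subset_univ _))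
  rcases eq_toClosure_or_eq_germPoint x with ⟨q, rfl⟩ | ⟨w, rfl⟩
  · exfalso
    have h := CantorBendixson.perfectKernel_subset_iteratedDerivedSet _ (0 + 1) hx
    rw [CantorBendixson.iteratedDerivedSet_succ, CantorBendixson.iteratedDerivedSet_zero] at h
    obtain ⟨y, hy, hne⟩ := accPt_iff_nhds.1 h.1 _ ((isOpen_singleton_toClosure q).mem_nhds rfl)
    exact hne hy.1
  · exact ⟨w, rfl⟩

/-- The homeomorphism from the perfect kernel to the Cantor set inverse to `germPoint`. -/
noncomputable def kernelHomeomorph : kernelD ≃ₜ Cantor :=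
  (Homeomorph.setCongr kernelD_eq_range_germPoint).trans
    (continuous_germPoint.isClosedEmbedding germPoint_injective).isEmbedding.toHomeomorph.symm

theorem germPoint_kernelHomeomorph (Γ : kernelD) : germPoint (kernelHomeomorph Γ) = Γ.1 := by
  have h := (continuous_germPoint.isClosedEmbedding
    germPoint_injective).isEmbedding.toHomeomorph_apply_coe (kernelHomeomorph Γ)
  rw [← h, kernelHomeomorph, Homeomorph.trans_apply, Homeomorph.apply_symm_apply]
  rfl

theorem isBaseLabel_germPoint (w : Cantor) : IsBaseLabel (germPoint w) w :=
  (tendsto_comap.mono_left (comap_toClosure_nhds_le w)).mono_right nhdsWithin_le_nhds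

end ThompsonSchreier

theorem mainTheorem1 :
    (∃! A : MulAction ThompsonSchreier.F ThompsonSchreier.SchreierClosure,
      ThompsonSchreier.IsSchreierSystem A) ∧
    ∀ A : MulAction ThompsonSchreier.F ThompsonSchreier.SchreierClosure,
      ThompsonSchreier.IsSchreierSystem A →
      ∃ (hD : ∀ (f : ThompsonSchreier.F) (Γ : ThompsonSchreier.kernelD),
          A.smul f Γ.1 ∈ ThompsonSchreier.kernelD)
        (ψ : ThompsonSchreier.kernelD ≃ₜ ThompsonSchreier.Cantor),
        (∀ (f : ThompsonSchreier.F) (Γ : ThompsonSchreier.kernelD),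
          ψ ⟨A.smul f Γ.1, hD f Γ⟩ = f • ψ Γ) ∧
        ∀ Γ : ThompsonSchreier.kernelD, ThompsonSchreier.IsBaseLabel Γ.1 (ψ Γ) := by
  open ThompsonSchreier in
  refine ⟨⟨schreierAction, isSchreierSystem_schreierAction, fun A hA =>
    hA.eq isSchreierSystem_schreierAction⟩, fun A hA => ?_⟩
  obtain rfl := hA.eq isSchreierSystem_schreierAction
  have hsmul : ∀ (f : F) (Γ : kernelD),
      schreierAction.smul f Γ.1 = germPoint (f • kernelHomeomorph Γ) := fun f Γ => by
    rw [← schreierAction_germPoint, germPoint_kernelHomeomorph]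
  refine ⟨fun f Γ => ?_, kernelHomeomorph, fun f Γ => ?_, fun Γ => ?_⟩
  · rw [hsmul]
    exact kernelD_eq_range_germPoint.ge ⟨_, rfl⟩
  · exact germPoint_injective ((germPoint_kernelHomeomorph _).trans (hsmul f Γ))
  · have := isBaseLabel_germPoint (kernelHomeomorph Γ)
    rwa [germPoint_kernelHomeomorph] at this
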